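/- **Setting.** Let $(Q,D,L)$ be a nonholonomic system: $Q$ is a smooth manifold, $D\subset TQ$ a smooth vector subbundle of rank $r$, and $L=K-U$, where $K$ is the kinetic energy of a Riemannian metric $\langle\!\langle\cdot,\cdot\rangle\!\rangle$ on $Q$ and $U\in C^\infty(Q)$. Let $\mathcal P:TQ\to D$ be the orthogonal projector. Let a Lie group $G$ act smoothly, freely and properly on $Q$, preserving the metric, $U$ and $D$, and suppose that $T_qQ=D_q\oplus(\mathfrak g\cdot q)$ for all $q\in Q$ (a *$G$-Chaplygin system*). Let $\pi:Q\to S=Q/G$ be the projection onto the $r$-dimensional shape space. For $u\in T_{\pi(q)}S$ let $\mathrm{hor}_q u\in D_q$ be the vector with $T_q\pi(\mathrm{hor}_q u)=u$; this defines the horizontal lift $\mathrm{hor}\,Y$ of a vector field $Y$ on $S$. *Dynamics.* On the dual bundle $D^*$ let $\{f,k\}_{D^*}=\{f\circ i_D^*,k\circ i_D^*\}_{T^*Q}\circ\mathcal P^*$, where $i_D^*:T^*Q\to D^*$ and $\mathcal P^*:D^*\to T^*Q$ are dual to the inclusion $D\subset TQ$ and to $\mathcal P$, and $\{\cdot,\cdot\}_{T^*Q}$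 is the canonical Poisson bracket (with $\{q^i,p_j\}=\delta^i_j$). Let $h_c=h\circ\mathcal P^*$ with $h(\alpha)=\frac12\|\alpha\|^2+U(q)$ for $\alpha\in T^*_qQ$, and let $X_{nh}$ be the vector field on $D^*$ with $X_{nh}[f]=\{f,h_c\}_{D^*}$. The map $D^*\to D^*/G\cong T^*S$, $\beta\in D^*_q\mapsto\beta\circ\mathrm{hor}_q\in T^*_{\pi(q)}S$, carries $h_c$ and $X_{nh}$ to the reduced Hamiltonian $H\in C^\infty(T^*S)$ and the reduced vector field $\overline X_{nh}$ on $T^*S$. *Gyroscopic tensor.* For vector fields $Y,Z$ on $S$ let $$\mathcal T(Y,Z)(s)=T_q\pi\big(\mathcal P[\mathrm{hor}\,Y,\mathrm{hor}\,Z](q)\big)-[Y,Z](s),\qquad \pi(q)=s;$$ this does not depend on the choice of $q$ and is a tensor field. With $\tau:T^*S\to S$ the projection and $\Omega_{can}$ the canonical symplectic form of $T^*S$ (locally $\sum_i ds^i\wedge dp_i$), let $\Omega_{nh}=\Omega_{can}+\Omega_{\mathcal T}$, where $$\Omega_{\mathcal T}(\alpha)(V,W)=\alpha\big(\mathcal T(T_\alpha\tau(V),T_\alpha\tau(W))\big),\qquad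 \alpha\in T^*S,\ V,W\in T_\alpha(T^*S).$$ For $\phi\in C^\infty(S)$ the system is called *$\phi$-simple* if $\mathcal T(Y,Z)=Z[\phi]\,Y-Y[\phi]\,Z$ for all vector fields $Y,Z$ on $S$. **Corollary.** Every $\phi$-simple Chaplygin system is Hamiltonisable with the time reparametrisation $dt=\exp(-\phi(s))\,d\tau$ and the symplectic form $\exp(\phi\circ\tau)\,\Omega_{nh}$. That is, $\exp(\phi\circ\tau)\,\Omega_{nh}$ is a symplectic form (a smooth, closed, non-degenerate 2-form) on $T^*S$, and the rescaled reduced vector field $\exp(-\phi\circ\tau)\,\overline X_{nh}$ is the Hamiltonian vector field of $H$ with respect to it: $$\mathbf i_{\exp(-\phi\circ\tau)\overline X_{nh}}\big(\exp(\phi\circ\tau)\,\Omega_{nh}\big)=dH .$$ -/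

import Mathlib

open scoped Manifold ContDiff Bundle Topology
open Bundle (TotalSpace ContMDiffRiemannianMetric)

noncomputable section

/-! ### Differential forms on manifolds -/

section Forms

variable {E : Type*} [NormedAddCommGroup E] [NormedSpace ℝ E]
  {H : Type*} [TopologicalSpace H] {M : Type*} [TopologicalSpace M] [ChartedSpace H M]

/-- A differential `k`-form on `M` (with no regularity): an alternating `k`-linear form on every
tangent space. -/
abbrev DiffForm (I : ModelWithCorners ℝ E H) (M : Type*) [TopologicalSpace M] [ChartedSpace H M]
    (k : ℕ) : Type _ :=
  ∀ x : M, (TangentSpace I x) [⋀^Fin k]→L[ℝ] ℝ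

variable {I : ModelWithCorners ℝ E H} {k : ℕ}

/-- The expression of a form in the preferred chart around `x₀`: its pull-back by the inverse of the
chart, a form on the model space. -/
def formInChart (η : DiffForm I M k) (x₀ : M) (y : E) : E [⋀^Fin k]→L[ℝ] ℝ :=
  (η ((extChartAt I x₀).symm y)).compContinuousLinearMap
    (mfderivWithin 𝓘(ℝ, E) I (extChartAt I x₀).symm (Set.range I) y)

/-- Smooth forms: all the expressions in charts are smooth. -/
def IsSmoothForm (η : DiffForm I M k) : Prop :=
  ∀ x₀ : M, ContDiffOn ℝ ∞ (formInChart η x₀) (extChartAt I x₀).target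

/-- The exterior derivative of a form, computed at `x` in the preferred chart around `x`. -/
def mextDeriv (η : DiffForm I M k) : DiffForm I M (k + 1) := fun x =>
  (extDerivWithin (formInChart η x) (Set.range I) (extChartAt I x x)).compContinuousLinearMap
    (mfderiv I 𝓘(ℝ, E) (extChartAt I x) x)

/-- A symplectic form: a smooth, closed and non-degenerate `2`-form. -/
structure IsSymplecticForm (η : DiffForm I M 2) : Prop where
  smooth : IsSmoothForm η
  closed : ∀ x, mextDeriv η x = 0
  nondegenerate : ∀ (x : M) (u : TangentSpace I x), (∀ v, η x ![u, v] = 0) → u = 0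

/-- `u[f]`, the derivative of a function `f` at `x` in the direction `u`, i.e. `df(x)(u)`. -/
def dirDeriv (I : ModelWithCorners ℝ E H) (f : M → ℝ) (x : M) (u : TangentSpace I x) : ℝ :=
  mfderiv I 𝓘(ℝ, ℝ) f x u

/-- Smoothness of a vector field, as a section of the tangent bundle. -/
def IsSmoothField (I : ModelWithCorners ℝ E H) [IsManifold I 1 M]
    (X : ∀ x : M, TangentSpace I x) : Prop :=
  ContMDiff I I.tangent ∞ (fun x => (⟨x, X x⟩ : TangentBundle I M))

/-- The vector `u` at `x` with `i_u η = df(x)` (it exists and is unique where `η` is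
non-degenerate). -/
def hamiltonianVector (η : DiffForm I M 2) (f : M → ℝ) (x : M) : TangentSpace I x :=
  Classical.epsilon fun u => ∀ v, η x ![u, v] = dirDeriv I f x v

end Forms

/-! ### Cotangent bundles -/

section Cotangent

variable (E : Type*) [NormedAddCommGroup E] [NormedSpace ℝ E]
  (M : Type*) [TopologicalSpace M] [ChartedSpace E M] [IsManifold 𝓘(ℝ, E) ∞ M]

/-- The cotangent bundle `T*M` of a manifold modelled on `E`, as a smooth vector bundle. -/
abbrev CotangentBundle : Type _ :=
  TotalSpace (E →L[ℝ] ℝ) (fun x : M => TangentSpace 𝓘(ℝ, E) x →L[ℝ] ℝ)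

/-- The model with corners of the cotangent bundle. -/
abbrev cotangentModel :=
  (𝓘(ℝ, E)).prod 𝓘(ℝ, E →L[ℝ] ℝ)

variable {E M}

/-- The Liouville `1`-form `λ(α)(U) = α(Tτ U)`, with `τ` the bundle projection. -/
def liouvilleForm : DiffForm (cotangentModel E) (CotangentBundle E M) 1 := fun α =>
  ContinuousAlternatingMap.ofSubsingleton ℝ _ _ 0
    (α.2.comp (mfderiv (cotangentModel E) 𝓘(ℝ, E) TotalSpace.proj α))

/-- The canonical symplectic form `Ω_can = -dλ`, locally `∑ dsⁱ ∧ dpᵢ`. -/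
def canonicalForm : DiffForm (cotangentModel E) (CotangentBundle E M) 2 := fun α =>
  -mextDeriv liouvilleForm α

/-- The canonical Poisson bracket on `T*M`, `{f, g} = X_g[f]`, so that `{qⁱ, pⱼ} = δⁱⱼ`. -/
def poissonBracket (f g : CotangentBundle E M → ℝ) (α : CotangentBundle E M) : ℝ :=
  dirDeriv (cotangentModel E) f α (hamiltonianVector canonicalForm g α)

end Cotangent

/-! ### Nonholonomic systems -/

section Nonholonomic

/-- A nonholonomic system `(Q, D, L)` with configuration manifold `Q`, constraint distribution `D`
of rank `r` and Lagrangian `L = K - U` of mechanical type, `K` being the kinetic energy of a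
Riemannian metric. -/
structure NonholonomicSystem (E Q : Type*) [NormedAddCommGroup E] [NormedSpace ℝ E]
    [TopologicalSpace Q] [ChartedSpace E Q] [IsManifold 𝓘(ℝ, E) ∞ Q] (r : ℕ) where
  /-- the kinetic energy metric -/
  metric : ContMDiffRiemannianMetric 𝓘(ℝ, E) ∞ E (fun q : Q => TangentSpace 𝓘(ℝ, E) q)
  /-- the potential energy -/
  U : Q → ℝ
  smooth_U : ContMDiff 𝓘(ℝ, E) 𝓘(ℝ, ℝ) ∞ U
  /-- the constraint distribution -/
  D : ∀ q : Q, Submodule ℝ (TangentSpace 𝓘(ℝ, E) q)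
  finrank_D : ∀ q, Module.finrank ℝ (D q) = r
  /-- `D` is a smooth subbundle: it is spanned by smooth local vector fields. -/
  smooth_D : ∀ q₀ : Q, ∃ W ∈ 𝓝 q₀, ∃ X : Fin r → ∀ q : Q, TangentSpace 𝓘(ℝ, E) q,
    (∀ i, ContMDiffOn 𝓘(ℝ, E) (𝓘(ℝ, E)).tangent ∞
      (fun q => (⟨q, X i q⟩ : TangentBundle 𝓘(ℝ, E) Q)) W) ∧
    ∀ q ∈ W, D q = Submodule.span ℝ (Set.range fun i => X i q)

variable {E Q : Type*} [NormedAddCommGroup E] [NormedSpace ℝ E] [FiniteDimensional ℝ E]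
  [TopologicalSpace Q] [ChartedSpace E Q] [IsManifold 𝓘(ℝ, E) ∞ Q] {r : ℕ}

instance tangentSpace_finiteDimensional (q : Q) : FiniteDimensional ℝ (TangentSpace 𝓘(ℝ, E) q) :=
  inferInstanceAs (FiniteDimensional ℝ E)
instance tangentSpace_t2Space (q : Q) : T2Space (TangentSpace 𝓘(ℝ, E) q) :=
  inferInstanceAs (T2Space E)

namespace NonholonomicSystem

variable (N : NonholonomicSystem E Q r)

/-- The orthogonal complement `D^⊥` with respect to the kinetic energy metric. -/
def orthD (q : Q) : Submodule ℝ (TangentSpace 𝓘(ℝ, E) q) where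
  carrier := {v | ∀ w ∈ N.D q, N.metric.inner q v w = 0}
  add_mem' := fun ha hb w hw => by simp [ha w hw, hb w hw]
  zero_mem' := fun w _ => by simp
  smul_mem' := fun c v hv w hw => by simp [hv w hw]

theorem isCompl_D_orthD (q : Q) : IsCompl (N.D q) (N.orthD q) := by
  have key : N.orthD q = LinearMap.BilinForm.orthogonal (LinearMap.mk₂ ℝ
      (fun v w => N.metric.inner q v w) (by simp) (by simp) (by simp) (by simp)) (N.D q) := by
    ext v
    simp only [orthD, Submodule.mem_mk, LinearMap.BilinForm.mem_orthogonal_iff]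
    exact forall₂_congr fun w _ => by
      rw [N.metric.symm]; rfl
  rw [key, LinearMap.BilinForm.isCompl_orthogonal_iff_disjoint, ← key, Submodule.disjoint_def]
  · intro v hv hv'
    by_contra hne
    exact (N.metric.pos q v hne).ne' (hv' v hv)
  · intro v w h
    have h' : N.metric.inner q v w = 0 := h
    rw [N.metric.symm] at h'
    exact h'

/-- The orthogonal projector `P : TQ → D`. -/
def proj (q : Q) : TangentSpace 𝓘(ℝ, E) q →ₗ[ℝ] N.D q :=
  (N.D q).projectionOnto (N.orthD q) (N.isCompl_D_orthD q)

/-- The total space of the dual bundle `D*`. -/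
abbrev DualD : Type _ := Σ q : Q, Module.Dual ℝ (N.D q)

/-- The projection `i_D^* : T*Q → D*`, dual to the inclusion `D ⊂ TQ`. -/
def dualIncl (α : CotangentBundle E Q) : N.DualD :=
  ⟨α.1, α.2.toLinearMap ∘ₗ (N.D α.1).subtype⟩

/-- The inclusion `P^* : D* → T*Q`, dual to the orthogonal projector. -/
def dualProj (β : N.DualD) : CotangentBundle E Q :=
  ⟨β.1, (β.2 ∘ₗ N.proj β.1).toContinuousLinearMap⟩

/-- The nonholonomic bracket of functions on `D*`. -/
def bracket (f g : N.DualD → ℝ) (β : N.DualD) : ℝ :=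
  poissonBracket (f ∘ N.dualIncl) (g ∘ N.dualIncl) (N.dualProj β)

/-- The Hamiltonian `h(α) = ½‖α‖² + U(q)` on `T*Q`; the norm is the one induced by the metric,
`‖α‖² = α(α^♯)`. -/
def hamiltonian (α : CotangentBundle E Q) : ℝ :=
  1 / 2 * α.2 ((N.metric.inner α.1).inverse α.2) + N.U α.1

/-- The constrained Hamiltonian `h_c = h ∘ P^*` on `D*`. -/
def constrainedHamiltonian (β : N.DualD) : ℝ := N.hamiltonian (N.dualProj β)

/-- The nonholonomic dynamics `X_nh` on `D*`, as a derivation: `X_nh[f] = {f, h_c}`. -/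
def dynamics (f : N.DualD → ℝ) : N.DualD → ℝ := N.bracket f N.constrainedHamiltonian

end NonholonomicSystem

end Nonholonomic

/-! ### Chaplygin systems -/

section Chaplygin

variable (E Q : Type*) [NormedAddCommGroup E] [NormedSpace ℝ E] [FiniteDimensional ℝ E]
  [TopologicalSpace Q] [ChartedSpace E Q] [IsManifold 𝓘(ℝ, E) ∞ Q]
  (EG G : Type*) [NormedAddCommGroup EG] [NormedSpace ℝ EG]
  [Group G] [TopologicalSpace G] [ChartedSpace EG G]
  [MulAction G Q]

variable {Q} in
/-- The tangent space `𝔤 · q` at `q` of the `G`-orbit through `q`: the image of the Lie algebra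
`𝔤 = T₁G` by the derivative at `1` of `g ↦ g • q`. -/
def orbitTangentSpace (q : Q) : Submodule ℝ (TangentSpace 𝓘(ℝ, E) q) :=
  one_smul G q ▸ LinearMap.range
    (mfderiv 𝓘(ℝ, EG) 𝓘(ℝ, E) (fun g : G => g • q) 1).toLinearMap

variable (F S : Type*) [NormedAddCommGroup F] [NormedSpace ℝ F] [FiniteDimensional ℝ F]
  [TopologicalSpace S] [ChartedSpace F S] [IsManifold 𝓘(ℝ, F) ∞ S]

/-- A `G`-Chaplygin system with `r` degrees of freedom: a nonholonomic system with a free (smooth and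
proper) action of `G` that preserves the metric, the potential and the constraint distribution
`D`, where `D` is complementary to the orbits. The shape space `Q/G` is given as an `r`-dimensional
manifold `S` with a surjective submersion `π : Q → S` whose fibres are the orbits. -/
structure ChaplyginSystem [LieGroup 𝓘(ℝ, EG) ∞ G] [ContMDiffSMul 𝓘(ℝ, EG) 𝓘(ℝ, E) ∞ G Q]
    [ProperSMul G Q] (r : ℕ) extends NonholonomicSystem E Q r where
  free : ∀ (g : G) (q : Q), g • q = q → g = 1
  isometry : ∀ (g : G) (q : Q) (v w : TangentSpace 𝓘(ℝ, E) q),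
    metric.inner (g • q) (mfderiv 𝓘(ℝ, E) 𝓘(ℝ, E) (fun p : Q => g • p) q v)
      (mfderiv 𝓘(ℝ, E) 𝓘(ℝ, E) (fun p : Q => g • p) q w) = metric.inner q v w
  invariant_U : ∀ (g : G) (q : Q), U (g • q) = U q
  invariant_D : ∀ (g : G) (q : Q),
    (D q).map (mfderiv 𝓘(ℝ, E) 𝓘(ℝ, E) (fun p : Q => g • p) q).toLinearMap = D (g • q)
  splitting : ∀ q : Q, IsCompl (D q) (orbitTangentSpace E EG G q)
  /-- the projection onto the shape space -/
  shapeProj : Q → S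
  smooth_shapeProj : ContMDiff 𝓘(ℝ, E) 𝓘(ℝ, F) ∞ shapeProj
  surjective_shapeProj : Function.Surjective shapeProj
  submersion_shapeProj : ∀ q, Function.Surjective (mfderiv 𝓘(ℝ, E) 𝓘(ℝ, F) shapeProj q)
  fibre_shapeProj : ∀ q q' : Q, shapeProj q = shapeProj q' ↔ ∃ g : G, g • q = q'
  finrank_shape : Module.finrank ℝ F = r

variable {E Q EG G F S}
  [LieGroup 𝓘(ℝ, EG) ∞ G] [ContMDiffSMul 𝓘(ℝ, EG) 𝓘(ℝ, E) ∞ G Q] [ProperSMul G Q] {r : ℕ}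

namespace ChaplyginSystem

variable (C : ChaplyginSystem E Q EG G F S r)

theorem mfderiv_shapeProj_orbit (q : Q) (v : TangentSpace 𝓘(ℝ, E) q)
    (hv : v ∈ orbitTangentSpace E EG G q) :
    mfderiv 𝓘(ℝ, E) 𝓘(ℝ, F) C.shapeProj q v = 0 := by
  have cast : ∀ (p : Q) (h : p = q) (K : Submodule ℝ (TangentSpace 𝓘(ℝ, E) p)),
      (∀ u ∈ K, mfderiv 𝓘(ℝ, E) 𝓘(ℝ, F) C.shapeProj p u = 0) →
      v ∈ (h ▸ K : Submodule ℝ (TangentSpace 𝓘(ℝ, E) q)) →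
      mfderiv 𝓘(ℝ, E) 𝓘(ℝ, F) C.shapeProj q v = 0 := by
    rintro p rfl K hK hv
    exact hK v hv
  refine cast _ (one_smul G q) _ ?_ hv
  rintro _ ⟨ξ, rfl⟩
  have h1 : MDifferentiableAt 𝓘(ℝ, EG) 𝓘(ℝ, E) (fun g : G => g • q) 1 := by
    have : ContMDiff 𝓘(ℝ, EG) 𝓘(ℝ, E) ∞ (fun g : G => g • q) :=
      (ContMDiffSMul.contMDiff_smul (I := 𝓘(ℝ, EG)) (I' := 𝓘(ℝ, E)) (n := ∞)).comp (contMDiff_id.prodMk contMDiff_const)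
    exact this.mdifferentiableAt (by simp)
  have h2 : MDifferentiableAt 𝓘(ℝ, E) 𝓘(ℝ, F) C.shapeProj ((1 : G) • q) :=
    C.smooth_shapeProj.mdifferentiableAt (by simp)
  have h3 := mfderiv_comp (1 : G) h2 h1
  have h4 : (C.shapeProj ∘ fun g : G => g • q) = fun _ => C.shapeProj q := by
    funext g
    exact ((C.fibre_shapeProj q (g • q)).2 ⟨g, rfl⟩).symm
  rw [h4, mfderiv_const] at h3
  exact (DFunLike.congr_fun h3 ξ).symm

theorem bijective_mfderiv_shapeProj (q : Q) : Function.Bijective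
    ((mfderiv 𝓘(ℝ, E) 𝓘(ℝ, F) C.shapeProj q).toLinearMap ∘ₗ (C.D q).subtype) := by
  have hdim : Module.finrank ℝ (C.D q) =
      Module.finrank ℝ (TangentSpace 𝓘(ℝ, F) (C.shapeProj q)) :=
    (C.finrank_D q).trans C.finrank_shape.symm
  have hs : Function.Surjective
      ((mfderiv 𝓘(ℝ, E) 𝓘(ℝ, F) C.shapeProj q).toLinearMap ∘ₗ (C.D q).subtype) := by
    intro u
    obtain ⟨v, rfl⟩ := C.submersion_shapeProj q u
    obtain ⟨a, ha, b, hb, rfl⟩ := Submodule.mem_sup.1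
      ((C.splitting q).sup_eq_top ▸ Submodule.mem_top (x := v))
    refine ⟨⟨a, ha⟩, ?_⟩
    have := C.mfderiv_shapeProj_orbit q b hb
    simp [this]
  exact ⟨(LinearMap.injective_iff_surjective_of_finrank_eq_finrank hdim).2 hs, hs⟩

/-- The isomorphism `T_qπ : D_q ≃ T_{π(q)}S`. -/
def horEquiv (q : Q) : C.D q ≃ₗ[ℝ] TangentSpace 𝓘(ℝ, F) (C.shapeProj q) :=
  LinearEquiv.ofBijective _ (C.bijective_mfderiv_shapeProj q)

/-- The horizontal lift `hor_q : T_{π(q)}S → D_q`, inverse to `T_qπ : D_q → T_{π(q)}S`. -/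
def horAt (q : Q) : TangentSpace 𝓘(ℝ, F) (C.shapeProj q) →ₗ[ℝ] C.D q := (C.horEquiv q).symm

/-- The horizontal lift `hor Y` of a vector field `Y` on `S`. -/
def hor (Y : ∀ s : S, TangentSpace 𝓘(ℝ, F) s) (q : Q) : TangentSpace 𝓘(ℝ, E) q :=
  C.horAt q (Y (C.shapeProj q))

/-- `T_qπ(P [hor Y, hor Z](q)) - [Y, Z](π(q))`. -/
def gyroscopicAt (Y Z : ∀ s : S, TangentSpace 𝓘(ℝ, F) s) (q : Q) :
    TangentSpace 𝓘(ℝ, F) (C.shapeProj q) :=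
  mfderiv 𝓘(ℝ, E) 𝓘(ℝ, F) C.shapeProj q
      (C.proj q (VectorField.mlieBracket 𝓘(ℝ, E) (C.hor Y) (C.hor Z) q))
    - VectorField.mlieBracket 𝓘(ℝ, F) Y Z (C.shapeProj q)

/-- The gyroscopic tensor, `𝒯(Y, Z)(s) = T_qπ(P [hor Y, hor Z](q)) - [Y, Z](s)` with `q` a point
over `s`; by invariance the result does not depend on `q`. -/
def gyroscopicTensor (Y Z : ∀ s : S, TangentSpace 𝓘(ℝ, F) s) (s : S) :
    TangentSpace 𝓘(ℝ, F) s :=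
  Function.surjInv_eq C.surjective_shapeProj s ▸
    C.gyroscopicAt Y Z (Function.surjInv C.surjective_shapeProj s)

/-- The system is `φ`-simple: `φ` is smooth and `𝒯(Y, Z) = Z[φ] Y - Y[φ] Z` for all (smooth) vector
fields `Y, Z` on `S`. -/
def IsSimple (φ : S → ℝ) : Prop :=
  ContMDiff 𝓘(ℝ, F) 𝓘(ℝ, ℝ) ∞ φ ∧
  ∀ Y Z : ∀ s : S, TangentSpace 𝓘(ℝ, F) s,
    IsSmoothField 𝓘(ℝ, F) Y → IsSmoothField 𝓘(ℝ, F) Z → ∀ s,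
      C.gyroscopicTensor Y Z s =
        dirDeriv 𝓘(ℝ, F) φ s (Z s) • Y s - dirDeriv 𝓘(ℝ, F) φ s (Y s) • Z s

/-- The gyroscopic `2`-form `Ω_𝒯(α)(U, V) = α(𝒯(Tτ U, Tτ V))` on `T*S`. The value of the tensor `𝒯`
on two tangent vectors at a point is obtained by extending them to local vector fields (constant in
the trivialisation given by the preferred chart). -/
def gyroscopicForm (α : CotangentBundle F S) (U V : TangentSpace (cotangentModel F) α) : ℝ :=
  α.2 (C.gyroscopicTensor
    (FiberBundle.extend F (mfderiv (cotangentModel F) 𝓘(ℝ, F) TotalSpace.proj α U))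
    (FiberBundle.extend F (mfderiv (cotangentModel F) 𝓘(ℝ, F) TotalSpace.proj α V)) α.1)

/-- `Ω_nh = Ω_can + Ω_𝒯` on `T*S`. -/
def nonholonomicForm (α : CotangentBundle F S) (U V : TangentSpace (cotangentModel F) α) : ℝ :=
  canonicalForm α ![U, V] + C.gyroscopicForm α U V

/-- The reduction map `D* → D*/G ≅ T*S`, sending `β ∈ D*_q` to the covector `β ∘ hor_q` at `π(q)`.
Its fibres are the `G`-orbits in `D*`. -/
def reduction (β : C.DualD) : CotangentBundle F S :=
  ⟨C.shapeProj β.1, (β.2 ∘ₗ C.horAt β.1).toContinuousLinearMap⟩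

/-- `H` is the reduced Hamiltonian on `T*S`: the smooth function that pulls back to the constrained
Hamiltonian `h_c` on `D*`. It is unique, since the reduction map is onto. -/
def IsReducedHamiltonian (H : CotangentBundle F S → ℝ) : Prop :=
  ContMDiff (cotangentModel F) 𝓘(ℝ, ℝ) ∞ H ∧
  ∀ β : C.DualD, H (C.reduction β) = C.constrainedHamiltonian β

/-- `X` is the reduced vector field `X̄_nh` on `T*S`: the smooth vector field to which the
nonholonomic dynamics `X_nh` on `D*` is related by the reduction map. It is unique, since the
reduction map is onto and a tangent vector is determined by the derivatives of functions. -/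
def IsReducedField (X : ∀ α : CotangentBundle F S, TangentSpace (cotangentModel F) α) : Prop :=
  IsSmoothField (cotangentModel F) X ∧
  ∀ f : CotangentBundle F S → ℝ, ContMDiff (cotangentModel F) 𝓘(ℝ, ℝ) ∞ f →
    ∀ β : C.DualD, dirDeriv (cotangentModel F) f (C.reduction β) (X (C.reduction β)) =
      C.dynamics (f ∘ C.reduction) β

/-- The system is Hamiltonisable with the time reparametrisation `dt = g(s) dτ` and the symplectic
form `Ω` on `T*S`: `g` is smooth and positive, and the rescaled reduced vector field satisfies
`i_{g X̄_nh} Ω = dH`, with `H` the reduced Hamiltonian. -/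
def IsHamiltonisableWith (g : S → ℝ)
    (Ω : DiffForm (cotangentModel F) (CotangentBundle F S) 2) : Prop :=
  (∀ s, 0 < g s) ∧ ContMDiff 𝓘(ℝ, F) 𝓘(ℝ, ℝ) ∞ g ∧ IsSymplecticForm Ω ∧
  ∃ (H : CotangentBundle F S → ℝ)
    (X : ∀ α : CotangentBundle F S, TangentSpace (cotangentModel F) α),
    C.IsReducedHamiltonian H ∧ C.IsReducedField X ∧
    ∀ (α : CotangentBundle F S) (V : TangentSpace (cotangentModel F) α),
      Ω α ![g α.1 • X α, V] = dirDeriv (cotangentModel F) H α V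

end ChaplyginSystem

end Chaplygin

end

/-! For a `φ`-simple system the gyroscopic form is `λ ∧ dφ`, with `λ` the Liouville form: its value
on `(U, V)` is `dφ(V) α(U) - dφ(U) α(V)`, where `U, V` also stand for their projections to `S`.
Hence `exp(φ) Ω_nh = -exp(φ) dλ - exp(φ) dφ ∧ λ = -d(exp(φ) λ)`. This form is exact, so closed, and
it is non-degenerate because it differs from `exp(φ) Ω_can` only by a semi-basic term. This is the
content of `mextDeriv_scaledLiouvilleForm`, `isSymplecticForm_conformalForm` and
`IsSimple.gyroscopicForm_apply`.

The field `reducedField` is defined by the Hamiltonian equation, so what has to be proved is that it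
is the reduced nonholonomic field. Write `ρ : T*Q → T*S`, `α ↦ α ∘ hor`. Since reduction composed
with `i_D^*` is `ρ`, the nonholonomic bracket of `f` and `H` pulled back to `D*` is the canonical
bracket of `f ∘ ρ` and `H ∘ ρ` at `P^*β`. In charts this bracket is the canonical one on `T*S` plus
`(P^*β)([hor g, hor k])`, where `g` and `k` are the fibre derivatives of `H` and `f`, extended to
constant fields (`poissonBracket_comp_cotangentReduction`). As `P^*β = β ∘ P`, the extra term is the
reduced covector applied to `𝒯(g, k)` (`dualProj_bracket`). Solving the Hamiltonian equation on
`T*S` gives the same expression (`dirDeriv_reducedField`).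

The remaining work is smoothness and descent to `S`. The horizontal lift is smooth by inverting `Tπ`
on a local frame of `D`. Functions descend through smooth local sections of `π`. The reduced metric
and the tensor `𝒯` do not depend on the point of the fibre, because `G` preserves the metric and
`D`. -/

noncomputable section

/-! ### Exterior derivative of forms read in charts. -/

section Forms

variable {E : Type*} [NormedAddCommGroup E] [NormedSpace ℝ E]
  {H : Type*} [TopologicalSpace H] {M : Type*} [TopologicalSpace M] [ChartedSpace H M]
  {I : ModelWithCorners ℝ E H} {k : ℕ}

/-- The derivative of the inverse of a chart, as a map between model spaces, at a point of the
target. -/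
theorem mfderivWithin_extChartAt_symm_eq_comp [I.Boundaryless] [IsManifold I ∞ M] (x₀ x : M)
    {y : E} (hy : y ∈ (extChartAt I x₀).target)
    (hyx : (extChartAt I x₀).symm y ∈ (extChartAt I x).source) (v : E) :
    (mfderivWithin 𝓘(ℝ, E) I (extChartAt I x₀).symm (Set.range I) y v : E) =
      (mfderivWithin 𝓘(ℝ, E) I (extChartAt I x).symm (Set.range I)
        ((extChartAt I x ∘ (extChartAt I x₀).symm) y)
        (fderiv ℝ (extChartAt I x ∘ (extChartAt I x₀).symm) y v) : E) := by
  have : IsManifold I 1 M := IsManifold.of_le (n := ∞) (by simp)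
  have h0 : MDifferentiableAt 𝓘(ℝ, E) I (extChartAt I x₀).symm y := by
    rw [← mdifferentiableWithinAt_univ, ← I.range_eq_univ]
    exact mdifferentiableWithinAt_extChartAt_symm hy
  have h1 : MDifferentiableAt I 𝓘(ℝ, E) (extChartAt I x) ((extChartAt I x₀).symm y) :=
    mdifferentiableAt_extChartAt (by simpa using hyx)
  have h2 : MDifferentiableAt 𝓘(ℝ, E) I (extChartAt I x).symm
      ((extChartAt I x ∘ (extChartAt I x₀).symm) y) := by
    rw [← mdifferentiableWithinAt_univ, ← I.range_eq_univ]
    exact mdifferentiableWithinAt_extChartAt_symm ((extChartAt I x).map_source hyx)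
  have h10 := h1.comp y h0
  have heq : (extChartAt I x₀).symm =ᶠ[𝓝 y]
      (extChartAt I x).symm ∘ (extChartAt I x ∘ (extChartAt I x₀).symm) := by
    have hc : ContinuousAt (extChartAt I x₀).symm y := continuousAt_extChartAt_symm'' hy
    filter_upwards [hc.preimage_mem_nhds ((isOpen_extChartAt_source x).mem_nhds hyx)] with z hz
    exact ((extChartAt I x).left_inv hz).symm
  rw [I.range_eq_univ, mfderivWithin_univ, mfderivWithin_univ, ← mfderiv_eq_fderiv]
  have := heq.mfderiv_eq (I := 𝓘(ℝ, E)) (I' := I)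
  have h3 := mfderiv_comp y h2 h10
  exact (DFunLike.congr_fun (this) v).trans (DFunLike.congr_fun h3 v)

/-- Change of charts for the expression of a form. -/
theorem formInChart_change [I.Boundaryless] [IsManifold I ∞ M] (η : DiffForm I M k) (x₀ x : M)
    {y : E} (hy : y ∈ (extChartAt I x₀).target)
    (hyx : (extChartAt I x₀).symm y ∈ (extChartAt I x).source) :
    formInChart η x₀ y =
      (formInChart η x ((extChartAt I x ∘ (extChartAt I x₀).symm) y)).compContinuousLinearMap
        (fderiv ℝ (extChartAt I x ∘ (extChartAt I x₀).symm) y) := by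
  ext v
  have hb : (extChartAt I x).symm ((extChartAt I x ∘ (extChartAt I x₀).symm) y) =
      (extChartAt I x₀).symm y := (extChartAt I x).left_inv hyx
  let η' : M → E [⋀^Fin k]→L[ℝ] ℝ := η
  change η' ((extChartAt I x₀).symm y) (fun i => mfderivWithin 𝓘(ℝ, E) I (extChartAt I x₀).symm
    (Set.range I) y (v i)) = η' ((extChartAt I x).symm _) (fun i => mfderivWithin 𝓘(ℝ, E) I
      (extChartAt I x).symm (Set.range I) ((extChartAt I x ∘ (extChartAt I x₀).symm) y)
        (fderiv ℝ (extChartAt I x ∘ (extChartAt I x₀).symm) y (v i)))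
  rw [hb]
  congr 1
  funext i
  exact mfderivWithin_extChartAt_symm_eq_comp x₀ x hy hyx (v i)

theorem contDiffAt_extChartAt_comp_symm [I.Boundaryless] [IsManifold I ∞ M] (x₀ x : M)
    {y : E} (hy : y ∈ (extChartAt I x₀).target)
    (hyx : (extChartAt I x₀).symm y ∈ (extChartAt I x).source) :
    ContDiffAt ℝ ∞ (extChartAt I x ∘ (extChartAt I x₀).symm) y := by
  have h := contDiffWithinAt_ext_coord_change (n := ∞) (I := I) x x₀ (y := y)
    ⟨hy, hyx⟩
  rwa [I.range_eq_univ, contDiffWithinAt_univ] at h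

theorem minSmoothness_two_le_infty : minSmoothness ℝ 2 ≤ (∞ : WithTop ℕ∞) := by
  rw [minSmoothness_of_isRCLikeNormedField]
  exact WithTop.coe_le_coe.2 le_top

/-- `mextDeriv` uses a different chart at every point. Naturality of `d` under the coordinate change
identifies all these values with one exterior derivative in the fixed chart around `x₀`, which makes
both smoothness and `d ∘ d = 0` accessible. -/
theorem formInChart_mextDeriv [I.Boundaryless] [IsManifold I ∞ M] {η : DiffForm I M k}
    (hη : IsSmoothForm η) (x₀ : M) {y : E} (hy : y ∈ (extChartAt I x₀).target) :
    formInChart (mextDeriv η) x₀ y = extDeriv (formInChart η x₀) y := by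
  have : IsManifold I 1 M := IsManifold.of_le (n := ∞) (by simp)
  set x := (extChartAt I x₀).symm y with hx
  have hyx : (extChartAt I x₀).symm y ∈ (extChartAt I x).source := mem_extChartAt_source x
  have hfy : (extChartAt I x ∘ (extChartAt I x₀).symm) y = extChartAt I x x := rfl
  have heq : formInChart η x₀ =ᶠ[𝓝 y] fun y =>
      (formInChart η x ((extChartAt I x ∘ (extChartAt I x₀).symm) y)).compContinuousLinearMap
        (fderiv ℝ (extChartAt I x ∘ (extChartAt I x₀).symm) y) := by
    have hc : ContinuousAt (extChartAt I x₀).symm y := continuousAt_extChartAt_symm'' hy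
    filter_upwards [hc.preimage_mem_nhds ((isOpen_extChartAt_source x).mem_nhds hyx),
      (isOpen_extChartAt_target x₀).mem_nhds hy] with z hz hz'
    exact formInChart_change η x₀ x hz' hz
  have hd : DifferentiableAt ℝ (formInChart η x)
      ((extChartAt I x ∘ (extChartAt I x₀).symm) y) :=
    ((hη x).contDiffAt ((isOpen_extChartAt_target x).mem_nhds (mem_extChartAt_target x)))
      |>.differentiableAt (by simp)
  rw [heq.extDeriv_eq, extDeriv_pullback hd (contDiffAt_extChartAt_comp_symm x₀ x hy hyx)
    minSmoothness_two_le_infty, formInChart_change (mextDeriv η) x₀ x hy hyx]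
  congr 1
  rw [hfy]
  ext v
  have hb : (extChartAt I x).symm (extChartAt I x x) = x := extChartAt_to_inv x
  let η' : M → E [⋀^Fin (k + 1)]→L[ℝ] ℝ := mextDeriv η
  change η' ((extChartAt I x).symm (extChartAt I x x)) (fun i => mfderivWithin 𝓘(ℝ, E) I
    (extChartAt I x).symm (Set.range I) (extChartAt I x x) (v i)) = _
  -- The preferred chart has identity derivative at its own centre, so the pull-backs on both sides
  -- are trivial there.
  rw [hb, mfderivWithin_range_extChartAt_symm]
  change (extDerivWithin (formInChart η x) (Set.range I) (extChartAt I x x) :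
    E [⋀^Fin (k + 1)]→L[ℝ] ℝ) (fun i => (mfderiv I 𝓘(ℝ, E) (extChartAt I x) x (v i) : E)) = _
  rw [mfderiv_extChartAt_self, I.range_eq_univ, extDerivWithin_univ]
  rfl

/-- The exterior derivative of a smooth form is smooth. -/
theorem IsSmoothForm.mextDeriv [I.Boundaryless] [IsManifold I ∞ M] {η : DiffForm I M k}
    (hη : IsSmoothForm η) : IsSmoothForm (mextDeriv η) := by
  intro x₀
  refine ContDiffOn.congr ?_ fun y hy => formInChart_mextDeriv hη x₀ hy
  exact (ContinuousAlternatingMap.alternatizeUncurryFinCLM ℝ E ℝ).contDiff.comp_contDiffOn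
    ((hη x₀).fderiv_of_isOpen (isOpen_extChartAt_target x₀) (m := ∞) le_rfl)

theorem mextDeriv_apply_self [I.Boundaryless] [IsManifold I ∞ M] (η : DiffForm I M k) (x : M)
    (v : Fin (k + 1) → E) :
    mextDeriv η x v = extDeriv (formInChart η x) (extChartAt I x x) v := by
  have : IsManifold I 1 M := IsManifold.of_le (n := ∞) (by simp)
  change (extDerivWithin (formInChart η x) (Set.range I) (extChartAt I x x) :
    E [⋀^Fin (k + 1)]→L[ℝ] ℝ) (fun i => (mfderiv I 𝓘(ℝ, E) (extChartAt I x) x (v i) : E)) = _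
  rw [mfderiv_extChartAt_self, I.range_eq_univ, extDerivWithin_univ]
  rfl

theorem mextDeriv_mextDeriv [I.Boundaryless] [IsManifold I ∞ M] {η : DiffForm I M k}
    (hη : IsSmoothForm η) (x : M) : _root_.mextDeriv (_root_.mextDeriv η) x = 0 := by
  ext v
  have hn : (extChartAt I x).target ∈ 𝓝 (extChartAt I x x) :=
    (isOpen_extChartAt_target x).mem_nhds (mem_extChartAt_target x)
  have heq : formInChart (_root_.mextDeriv η) x =ᶠ[𝓝 (extChartAt I x x)]
      extDeriv (formInChart η x) := by
    filter_upwards [hn] with y hy using formInChart_mextDeriv hη x hy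
  have h0 : extDeriv (formInChart (_root_.mextDeriv η) x) (extChartAt I x x) = 0 :=
    heq.extDeriv_eq.trans (extDeriv_extDeriv_apply ((hη x).contDiffAt hn)
      minSmoothness_two_le_infty)
  exact (mextDeriv_apply_self (E := E) (I := I) _ x v).trans (DFunLike.congr_fun h0 v)

end Forms

/-! ### Smooth solutions of linear systems. -/

section Solve

variable {E : Type*} [NormedAddCommGroup E] [NormedSpace ℝ E]
  {H : Type*} [TopologicalSpace H] {M : Type*} [TopologicalSpace M] [ChartedSpace H M]
  {I : ModelWithCorners ℝ E H}
  {V W : Type*} [NormedAddCommGroup V] [NormedSpace ℝ V]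
  [NormedAddCommGroup W] [NormedSpace ℝ W]

theorem ContMDiffAt.clm_inverse [CompleteSpace V] {B : M → V →L[ℝ] W} {x₀ : M} {n : WithTop ℕ∞}
    (hB : ContMDiffAt I 𝓘(ℝ, V →L[ℝ] W) n B x₀) (hinv : (B x₀).IsInvertible) :
    ContMDiffAt I 𝓘(ℝ, W →L[ℝ] V) n (fun x => (B x).inverse) x₀ := by
  obtain ⟨e, he⟩ := hinv
  have h : ContDiffAt ℝ n ContinuousLinearMap.inverse (B x₀) := he ▸ contDiffAt_map_inverse e
  exact h.contMDiffAt.comp x₀ hB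

theorem ContMDiffAt.eventually_isInvertible [CompleteSpace V] {B : M → V →L[ℝ] W} {x₀ : M}
    {n : WithTop ℕ∞} (hB : ContMDiffAt I 𝓘(ℝ, V →L[ℝ] W) n B x₀)
    (hinv : (B x₀).IsInvertible) : ∀ᶠ x in 𝓝 x₀, (B x).IsInvertible := by
  obtain ⟨e, he⟩ := hinv
  have h := e.nhds
  rw [he] at h
  exact hB.continuousAt.preimage_mem_nhds h

/-- Cramer's rule: the solution of a smooth system of linear equations is smooth. -/
theorem ContMDiffAt.of_clm_apply_eq [CompleteSpace V] {B : M → V →L[ℝ] W} {g : M → W}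
    {ξ : M → V} {x₀ : M} {n : WithTop ℕ∞} (hB : ContMDiffAt I 𝓘(ℝ, V →L[ℝ] W) n B x₀)
    (hinv : (B x₀).IsInvertible) (hg : ContMDiffAt I 𝓘(ℝ, W) n g x₀)
    (hξ : ∀ᶠ x in 𝓝 x₀, B x (ξ x) = g x) : ContMDiffAt I 𝓘(ℝ, V) n ξ x₀ := by
  refine ((hB.clm_inverse hinv).clm_apply hg).congr_of_eventuallyEq ?_
  -- `inverse` has a junk value at non-invertible maps, so `ξ = B⁻¹ g` is used only on the
  -- neighbourhood where `B` is invertible.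
  filter_upwards [hξ, hB.eventually_isInvertible hinv] with x hx hi
  obtain ⟨e, he⟩ := hi
  rw [← hx, ← he]
  simp

theorem ContinuousLinearMap.isInvertible_of_injective [FiniteDimensional ℝ V]
    [FiniteDimensional ℝ W] (h : Module.finrank ℝ V = Module.finrank ℝ W) {B : V →L[ℝ] W}
    (hB : Function.Injective B) : B.IsInvertible :=
  ⟨(LinearEquiv.ofInjectiveOfFinrankEq B.toLinearMap hB h).toContinuousLinearEquiv, by
    ext; rfl⟩

/-- The trivialisations of the tangent bundle are the derivatives of the charts. -/
theorem trivializationAt_tangentSpace_apply [IsManifold I 1 M] {x₀ x : M}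
    (hx : x ∈ (extChartAt I x₀).source) (v : TangentSpace I x) :
    (trivializationAt E (TangentSpace I : M → Type _) x₀ ⟨x, v⟩).2 =
      mfderiv I 𝓘(ℝ, E) (extChartAt I x₀) x v := by
  have hx' : x ∈ (chartAt H x₀).source := by simpa using hx
  refine Eq.trans ?_ (DFunLike.congr_fun
    (TangentBundle.continuousLinearMapAt_trivializationAt (I := I) hx') v)
  exact (congrFun ((trivializationAt E (TangentSpace I : M → Type _) x₀).coe_linearMapAt_of_mem
    (R := ℝ) (b := x) hx') v).symm

end Solve

/-! ### Hamiltonian vector fields of symplectic forms. -/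

section Symplectic

variable {E : Type*} [NormedAddCommGroup E] [NormedSpace ℝ E] [FiniteDimensional ℝ E]
  {H : Type*} [TopologicalSpace H] {M : Type*} [TopologicalSpace M] [ChartedSpace H M]
  {I : ModelWithCorners ℝ E H}

/-- The bilinear form of an alternating `2`-form. -/
def ContinuousAlternatingMap.toBilin (σ : E [⋀^Fin 2]→L[ℝ] ℝ) : E →L[ℝ] E →L[ℝ] ℝ :=
  LinearMap.toContinuousLinearMap
    { toFun u := LinearMap.toContinuousLinearMap
        { toFun w := σ ![u, w]
          map_add' a b := by
            have h := σ.map_update_add ![u, 0] 1 a b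
            have e (x : E) : ![u, x] = Function.update ![u, 0] 1 x := by funext i; fin_cases i <;> rfl
            simp only [← e] at h
            exact h
          map_smul' c a := by
            have h := σ.map_update_smul ![u, 0] 1 c a
            have e (x : E) : ![u, x] = Function.update ![u, 0] 1 x := by funext i; fin_cases i <;> rfl
            simp only [← e] at h
            exact h }
      map_add' a b := by
        ext w
        have h := σ.map_update_add ![0, w] 0 a b
        have e (x : E) : ![x, w] = Function.update ![0, w] 0 x := by funext i; fin_cases i <;> rfl
        simp only [← e] at h
        exact h
      map_smul' c a := by
        ext w
        have h := σ.map_update_smul ![0, w] 0 c a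
        have e (x : E) : ![x, w] = Function.update ![0, w] 0 x := by funext i; fin_cases i <;> rfl
        simp only [← e] at h
        exact h }

@[simp]
theorem ContinuousAlternatingMap.toBilin_apply (σ : E [⋀^Fin 2]→L[ℝ] ℝ) (u w : E) :
    σ.toBilin u w = σ ![u, w] := rfl

theorem isInvertible_toBilin {σ : E [⋀^Fin 2]→L[ℝ] ℝ}
    (hσ : ∀ u, (∀ v, σ ![u, v] = 0) → u = 0) : σ.toBilin.IsInvertible := by
  refine ContinuousLinearMap.isInvertible_of_injective ?_ ?_
  · rw [← (LinearMap.toContinuousLinearMap (𝕜 := ℝ) (E := E) (F' := ℝ)).finrank_eq]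
    exact (Subspace.dual_finrank_eq (K := ℝ) (V := E)).symm
  · refine (injective_iff_map_eq_zero _).2 fun u hu => hσ u fun v => ?_
    exact DFunLike.congr_fun hu v

theorem exists_apply_eq_of_nondegenerate {σ : E [⋀^Fin 2]→L[ℝ] ℝ}
    (hσ : ∀ u, (∀ v, σ ![u, v] = 0) → u = 0) (ℓ : E →L[ℝ] ℝ) : ∃ u, ∀ v, σ ![u, v] = ℓ v := by
  obtain ⟨e, he⟩ := isInvertible_toBilin hσ
  refine ⟨e.symm ℓ, fun v => ?_⟩
  rw [← ContinuousAlternatingMap.toBilin_apply, ← he]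
  simp

/-- In finite dimension, non-degeneracy makes `u ↦ η(u, ·)` onto the dual, so the choice operator
has a solution to pick. -/
theorem hamiltonianVector_spec {η : DiffForm I M 2} {x : M}
    (hη : ∀ u : TangentSpace I x, (∀ v, η x ![u, v] = 0) → u = 0) (f : M → ℝ)
    (v : TangentSpace I x) : η x ![hamiltonianVector η f x, v] = dirDeriv I f x v :=
  Classical.epsilon_spec (p := fun u : TangentSpace I x => ∀ v, η x ![u, v] = dirDeriv I f x v)
    (exists_apply_eq_of_nondegenerate (E := E) (σ := η x) hη (mfderiv I 𝓘(ℝ, ℝ) f x)) v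

/-- The Hamiltonian vector field of a smooth function with respect to a symplectic form is
smooth. -/
theorem IsSymplecticForm.isSmoothField_hamiltonianVector [I.Boundaryless] [IsManifold I ∞ M]
    [IsManifold I 1 M]
    {η : DiffForm I M 2} (hη : IsSymplecticForm η) {f : M → ℝ} (hf : ContMDiff I 𝓘(ℝ, ℝ) ∞ f) :
    IsSmoothField I (hamiltonianVector η f) := by
  intro x₀
  rw [Bundle.contMDiffAt_section]
  set B : M → E →L[ℝ] E →L[ℝ] ℝ := fun x => (formInChart η x₀ (extChartAt I x₀ x)).toBilin
    with hBdef
  have hchart : ContMDiffAt I 𝓘(ℝ, E) ∞ (extChartAt I x₀) x₀ := contMDiffAt_extChartAt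
  have hn : (extChartAt I x₀).target ∈ 𝓝 (extChartAt I x₀ x₀) :=
    (isOpen_extChartAt_target x₀).mem_nhds (mem_extChartAt_target x₀)
  have hinv : ∀ y ∈ (extChartAt I x₀).target,
      (mfderivWithin 𝓘(ℝ, E) I (extChartAt I x₀).symm (Set.range I) y).IsInvertible :=
    fun y hy => isInvertible_mfderivWithin_extChartAt_symm hy
  have hB : ContMDiffAt I 𝓘(ℝ, E →L[ℝ] E →L[ℝ] ℝ) ∞ B x₀ := by
    have h : ContDiffAt ℝ ∞ (fun y => (formInChart η x₀ y).toBilin) (extChartAt I x₀ x₀) := by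
      refine ContDiffOn.contDiffAt ?_ hn
      refine contDiffOn_clm_apply.2 fun u => contDiffOn_clm_apply.2 fun w => ?_
      exact (ContinuousAlternatingMap.apply ℝ E ℝ ![u, w]).contDiff.comp_contDiffOn
        (hη.smooth x₀)
    exact h.contMDiffAt.comp x₀ hchart
  have hg : ContMDiffAt I 𝓘(ℝ, E →L[ℝ] ℝ) ∞
      (fun x => fderiv ℝ (f ∘ (extChartAt I x₀).symm) (extChartAt I x₀ x)) x₀ := by
    have h : ContDiffAt ℝ ∞ (f ∘ (extChartAt I x₀).symm) (extChartAt I x₀ x₀) := by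
      have h1 : ContMDiffAt 𝓘(ℝ, E) I ∞ (extChartAt I x₀).symm (extChartAt I x₀ x₀) :=
        (contMDiffOn_extChartAt_symm x₀).contMDiffAt hn
      exact (hf.contMDiffAt.comp _ h1).contDiffAt
    exact (h.fderiv_right (m := ∞) le_rfl).contMDiffAt.comp x₀ hchart
  -- Read in the chart around `x₀`, the Hamiltonian equation is a linear system with matrix `B` and
  -- right-hand side the differential of `f`. Invertibility at `x₀` comes from non-degeneracy,
  -- carried over by the invertible derivative of the inverse chart.
  refine ContMDiffAt.of_clm_apply_eq hB ?_ hg ?_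
  · refine isInvertible_toBilin fun u hu => ?_
    obtain ⟨e, he⟩ := hinv _ (mem_extChartAt_target x₀)
    refine (map_eq_zero_iff _ (e.injective)).1 (hη.nondegenerate _ _ fun v => ?_)
    have h := hu (e.symm v)
    rw [← h]
    change _ = (η _) (fun i => mfderivWithin 𝓘(ℝ, E) I (extChartAt I x₀).symm (Set.range I) _
      (![u, e.symm v] i))
    congr 1
    funext i
    rw [← he]
    fin_cases i
    · rfl
    · exact (e.apply_symm_apply v).symm
  · filter_upwards [(isOpen_extChartAt_source (I := I) x₀).mem_nhds (mem_extChartAt_source x₀)]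
      with x hx
    ext w
    rw [trivializationAt_tangentSpace_apply hx]
    set y := extChartAt I x₀ x with hy
    have hyt : y ∈ (extChartAt I x₀).target := (extChartAt I x₀).map_source hx
    have hxy : (extChartAt I x₀).symm y = x := (extChartAt I x₀).left_inv hx
    have hXX : (mfderivWithin 𝓘(ℝ, E) I (extChartAt I x₀).symm (Set.range I) y
        (mfderiv I 𝓘(ℝ, E) (extChartAt I x₀) x (hamiltonianVector η f x)) : E) =
        hamiltonianVector η f x :=
      DFunLike.congr_fun (mfderivWithin_extChartAt_symm_comp_mfderiv_extChartAt' (I := I) hx) _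
    have hd : MDifferentiableAt 𝓘(ℝ, E) I (extChartAt I x₀).symm y := by
      rw [← mdifferentiableWithinAt_univ, ← I.range_eq_univ]
      exact mdifferentiableWithinAt_extChartAt_symm hyt
    have hc := mfderiv_comp y (hf.mdifferentiableAt (by simp)) hd
    have hfd : (fderiv ℝ (f ∘ (extChartAt I x₀).symm) y w : ℝ) =
        mfderiv I 𝓘(ℝ, ℝ) f ((extChartAt I x₀).symm y)
          (mfderivWithin 𝓘(ℝ, E) I (extChartAt I x₀).symm (Set.range I) y w) := by
      rw [I.range_eq_univ, mfderivWithin_univ, ← mfderiv_eq_fderiv]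
      exact DFunLike.congr_fun hc w
    rw [hfd]
    let η' : M → E [⋀^Fin 2]→L[ℝ] ℝ := η
    let D : M → E →L[ℝ] ℝ := fun x => mfderiv I 𝓘(ℝ, ℝ) f x
    set w' : E := mfderivWithin 𝓘(ℝ, E) I (extChartAt I x₀).symm (Set.range I) y w with hw'
    have hspec : η' x ![hamiltonianVector η f x, w'] = D x w' :=
      hamiltonianVector_spec (hη.nondegenerate x) f w'
    change η' ((extChartAt I x₀).symm y) (fun i => mfderivWithin 𝓘(ℝ, E) I (extChartAt I x₀).symm
      (Set.range I) y (![mfderiv I 𝓘(ℝ, E) (extChartAt I x₀) x (hamiltonianVector η f x), w] i))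
      = D ((extChartAt I x₀).symm y) w'
    rw [hxy, ← hspec]
    congr 1
    funext i
    fin_cases i
    · exact hXX
    · rfl

end Symplectic

/-! ### Charts of the cotangent bundle and the forms `g λ`. -/

section Cotangent

theorem mfderiv_clm_comp_extChartAt_self {E : Type*} [NormedAddCommGroup E] [NormedSpace ℝ E]
    {H : Type*} [TopologicalSpace H] {M : Type*} [TopologicalSpace M] [ChartedSpace H M]
    {I : ModelWithCorners ℝ E H} [IsManifold I 1 M] {F : Type*} [NormedAddCommGroup F]
    [NormedSpace ℝ F] (L : E →L[ℝ] F) (x : M) (v : TangentSpace I x) :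
    mfderiv I 𝓘(ℝ, F) (fun y => L (extChartAt I x y)) x v = L v := by
  have h := mfderiv_comp x (I'' := 𝓘(ℝ, F)) (g := L) (I' := 𝓘(ℝ, E)) L.mdifferentiableAt
    (mdifferentiableAt_extChartAt (I := I) (mem_chart_source H x))
  rw [mfderiv_extChartAt_self, ContinuousLinearMap.mfderiv_eq] at h
  exact DFunLike.congr_fun h v

theorem contDiff_ofSubsingleton {V : Type*} [NormedAddCommGroup V] [NormedSpace ℝ V]
    {n : WithTop ℕ∞} : ContDiff ℝ n fun L : V →L[ℝ] ℝ =>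
      ContinuousAlternatingMap.ofSubsingleton ℝ V ℝ (0 : Fin 1) L :=
  (ContinuousAlternatingMap.ofSubsingletonLIE (𝕜 := ℝ) (E := V) (F := ℝ) (0 : Fin 1)).contDiff

theorem MDifferentiableAt.hasFDerivAt_comp_extChartAt_symm {E : Type*} [NormedAddCommGroup E]
    [NormedSpace ℝ E] {H : Type*} [TopologicalSpace H] {M : Type*} [TopologicalSpace M]
    [ChartedSpace H M] {I : ModelWithCorners ℝ E H} [I.Boundaryless]
    {F : Type*} [NormedAddCommGroup F] [NormedSpace ℝ F] {f : M → F} {x : M}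
    (hf : MDifferentiableAt I 𝓘(ℝ, F) f x) :
    HasFDerivAt (f ∘ (extChartAt I x).symm) (show E →L[ℝ] F from mfderiv I 𝓘(ℝ, F) f x)
      (extChartAt I x x) := by
  rw [← hasFDerivWithinAt_univ, ← I.range_eq_univ]
  exact hf.hasMFDerivAt.2

variable {E : Type*} [NormedAddCommGroup E] [NormedSpace ℝ E]
  {M : Type*} [TopologicalSpace M] [ChartedSpace E M] [IsManifold 𝓘(ℝ, E) ∞ M]

theorem trivializationAt_cotangent_apply {x₀ x : M} (hx : x ∈ (extChartAt 𝓘(ℝ, E) x₀).source)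
    (α : TangentSpace 𝓘(ℝ, E) x →L[ℝ] ℝ) (v : E) :
    (trivializationAt (E →L[ℝ] ℝ) (fun x : M => TangentSpace 𝓘(ℝ, E) x →L[ℝ] ℝ) x₀ ⟨x, α⟩).2 v =
      α (mfderivWithin 𝓘(ℝ, E) 𝓘(ℝ, E) (extChartAt 𝓘(ℝ, E) x₀).symm (Set.range 𝓘(ℝ, E))
        (extChartAt 𝓘(ℝ, E) x₀ x) v) := by
  have : IsManifold 𝓘(ℝ, E) 1 M := IsManifold.of_le (n := ∞) (by simp)
  have hx' : x ∈ (chartAt E x₀).source := by simpa using hx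
  rw [← TangentBundle.symmL_trivializationAt hx']
  have h : (trivializationAt (E →L[ℝ] ℝ) (fun x : M => TangentSpace 𝓘(ℝ, E) x →L[ℝ] ℝ) x₀
      ⟨x, α⟩).2 v = (trivializationAt ℝ (fun x : M => ℝ) x₀).continuousLinearMapAt ℝ x
        (α ((trivializationAt E (TangentSpace 𝓘(ℝ, E)) x₀).symmL ℝ x v)) := rfl
  rw [h]
  simp
  rfl

theorem trivializationAt_cotangent_self (α : CotangentBundle E M) :
    (trivializationAt (E →L[ℝ] ℝ) (fun x : M => TangentSpace 𝓘(ℝ, E) x →L[ℝ] ℝ) α.1 α).2 =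
      α.2 := by
  have : IsManifold 𝓘(ℝ, E) 1 M := IsManifold.of_le (n := ∞) (by simp)
  ext v
  refine (trivializationAt_cotangent_apply (mem_extChartAt_source α.1) α.2 v).trans ?_
  rw [mfderivWithin_range_extChartAt_symm]
  rfl

theorem extChartAt_cotangent_fst (α₀ α : CotangentBundle E M) :
    (extChartAt (cotangentModel E) α₀ α).1 = extChartAt 𝓘(ℝ, E) α₀.1 α.1 := by
  rw [FiberBundle.extChartAt]
  rfl

theorem extChartAt_cotangent_snd (α₀ α : CotangentBundle E M) :
    (extChartAt (cotangentModel E) α₀ α).2 =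
      (trivializationAt (E →L[ℝ] ℝ) (fun x : M => TangentSpace 𝓘(ℝ, E) x →L[ℝ] ℝ) α₀.1 α).2 := by
  rw [FiberBundle.extChartAt]
  rfl

theorem mem_extChartAt_cotangent_source {α₀ α : CotangentBundle E M} :
    α ∈ (extChartAt (cotangentModel E) α₀).source ↔ α.1 ∈ (extChartAt 𝓘(ℝ, E) α₀.1).source := by
  rw [extChartAt_source, extChartAt_source, FiberBundle.chartedSpace_chartAt]
  simp only [mfld_simps]
  exact ⟨fun h => h.1.1, fun h => ⟨⟨h, trivial⟩, h⟩⟩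

/-- The base point of the inverse chart of the cotangent bundle. -/
theorem proj_extChartAt_cotangent_symm (α₀ : CotangentBundle E M) {y : E × (E →L[ℝ] ℝ)}
    (hy : y ∈ (extChartAt (cotangentModel E) α₀).target) :
    ((extChartAt (cotangentModel E) α₀).symm y).1 = (extChartAt 𝓘(ℝ, E) α₀.1).symm y.1 := by
  have h := (extChartAt (cotangentModel E) α₀).map_target hy
  rw [mem_extChartAt_cotangent_source] at h
  rw [← (extChartAt 𝓘(ℝ, E) α₀.1).left_inv h, ← extChartAt_cotangent_fst,
    (extChartAt (cotangentModel E) α₀).right_inv hy]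

/-- A tangent vector at `α` is a pair in `E × E*`, read in the bundle chart centred at `α`. The
charts of `T*M` at `α` and of `M` at its base point have identity derivative at their centres, so
`Tτ` is the first projection. -/
theorem mfderiv_cotangent_proj (α : CotangentBundle E M)
    (V : TangentSpace (cotangentModel E) α) :
    mfderiv (cotangentModel E) 𝓘(ℝ, E) TotalSpace.proj α V = (show E × (E →L[ℝ] ℝ) from V).1 := by
  have : IsManifold 𝓘(ℝ, E) 1 M := IsManifold.of_le (n := ∞) (by simp)
  have : IsManifold (cotangentModel E) 1 (CotangentBundle E M) :=
    IsManifold.of_le (n := ∞) (by simp)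
  have h := mfderiv_clm_comp_extChartAt_self (I := cotangentModel E)
    (ContinuousLinearMap.fst ℝ E (E →L[ℝ] ℝ)) α V
  have h2 : (fun a => ContinuousLinearMap.fst ℝ E (E →L[ℝ] ℝ) (extChartAt (cotangentModel E) α a))
      = extChartAt 𝓘(ℝ, E) α.1 ∘ (TotalSpace.proj : CotangentBundle E M → M) :=
    funext fun a => extChartAt_cotangent_fst α a
  rw [h2] at h
  have h3 := mfderiv_comp α (mdifferentiableAt_extChartAt (I := 𝓘(ℝ, E)) (mem_chart_source E α.1))
    (Bundle.mdifferentiable_proj (IB := 𝓘(ℝ, E)) (F := E →L[ℝ] ℝ)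
      (fun x : M => TangentSpace 𝓘(ℝ, E) x →L[ℝ] ℝ) α)
  rw [h3, mfderiv_extChartAt_self] at h
  exact h

theorem mfderiv_cotangent_trivialization (α : CotangentBundle E M)
    (V : TangentSpace (cotangentModel E) α) :
    mfderiv (cotangentModel E) 𝓘(ℝ, E →L[ℝ] ℝ) (fun a : CotangentBundle E M =>
      (trivializationAt (E →L[ℝ] ℝ) (fun x : M => TangentSpace 𝓘(ℝ, E) x →L[ℝ] ℝ) α.1 a).2) α V =
      (show E × (E →L[ℝ] ℝ) from V).2 := by
  have : IsManifold (cotangentModel E) 1 (CotangentBundle E M) :=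
    IsManifold.of_le (n := ∞) (by simp)
  have h := mfderiv_clm_comp_extChartAt_self (I := cotangentModel E)
    (ContinuousLinearMap.snd ℝ E (E →L[ℝ] ℝ)) α V
  have h2 : (fun a => ContinuousLinearMap.snd ℝ E (E →L[ℝ] ℝ) (extChartAt (cotangentModel E) α a))
      = fun a : CotangentBundle E M =>
      (trivializationAt (E →L[ℝ] ℝ) (fun x : M => TangentSpace 𝓘(ℝ, E) x →L[ℝ] ℝ) α.1 a).2 :=
    funext fun a => extChartAt_cotangent_snd α a
  rw [h2] at h
  exact h

/-- The `1`-form `g λ` on the cotangent bundle, for a function `g` on the base. -/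
def scaledLiouvilleForm (g : M → ℝ) : DiffForm (cotangentModel E) (CotangentBundle E M) 1 :=
  fun α => g α.1 • liouvilleForm α

theorem liouvilleForm_eq_scaledLiouvilleForm :
    (liouvilleForm : DiffForm (cotangentModel E) (CotangentBundle E M) 1) =
      scaledLiouvilleForm fun _ => 1 := by
  funext α
  simp [scaledLiouvilleForm]

/-- This is `g λ = g(q) p dq`: in a bundle chart `τ` is the first projection, and the fibre
coordinate is the covector composed with the derivative of the inverse base chart. -/
theorem formInChart_scaledLiouvilleForm (g : M → ℝ) (α₀ : CotangentBundle E M)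
    {y : E × (E →L[ℝ] ℝ)} (hy : y ∈ (extChartAt (cotangentModel E) α₀).target) :
    formInChart (scaledLiouvilleForm g) α₀ y =
      g ((extChartAt 𝓘(ℝ, E) α₀.1).symm y.1) • ContinuousAlternatingMap.ofSubsingleton ℝ _ _ 0
        (y.2.comp (ContinuousLinearMap.fst ℝ E (E →L[ℝ] ℝ))) := by
  have : IsManifold 𝓘(ℝ, E) 1 M := IsManifold.of_le (n := ∞) (by simp)
  have : IsManifold (cotangentModel E) 1 (CotangentBundle E M) :=
    IsManifold.of_le (n := ∞) (by simp)
  ext v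
  have hproj := proj_extChartAt_cotangent_symm α₀ hy
  set α := (extChartAt (cotangentModel E) α₀).symm y with hα
  have hαs : α ∈ (extChartAt (cotangentModel E) α₀).source :=
    (extChartAt (cotangentModel E) α₀).map_target hy
  have hyα : extChartAt (cotangentModel E) α₀ α = y :=
    (extChartAt (cotangentModel E) α₀).right_inv hy
  have hαs' := mem_extChartAt_cotangent_source.1 hαs
  have hy1 : extChartAt 𝓘(ℝ, E) α₀.1 α.1 = y.1 := by rw [← extChartAt_cotangent_fst, hyα]
  have hy2 (w : E) : y.2 w = α.2 (mfderivWithin 𝓘(ℝ, E) 𝓘(ℝ, E) (extChartAt 𝓘(ℝ, E) α₀.1).symm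
      (Set.range 𝓘(ℝ, E)) y.1 w) := by
    rw [← hy1, ← trivializationAt_cotangent_apply hαs' α.2 w, ← hyα, extChartAt_cotangent_snd]
  have hd : MDifferentiableAt 𝓘(ℝ, E × (E →L[ℝ] ℝ)) (cotangentModel E)
      (extChartAt (cotangentModel E) α₀).symm y := by
    rw [← mdifferentiableWithinAt_univ, ← (cotangentModel E).range_eq_univ]
    exact mdifferentiableWithinAt_extChartAt_symm hy
  have hd1 : MDifferentiableAt 𝓘(ℝ, E) 𝓘(ℝ, E) (extChartAt 𝓘(ℝ, E) α₀.1).symm y.1 := by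
    rw [← mdifferentiableWithinAt_univ, ← (𝓘(ℝ, E)).range_eq_univ, ← hy1]
    exact mdifferentiableWithinAt_extChartAt_symm ((extChartAt 𝓘(ℝ, E) α₀.1).map_source hαs')
  have h1 := mfderiv_comp y (Bundle.mdifferentiable_proj (IB := 𝓘(ℝ, E)) (F := E →L[ℝ] ℝ)
      (fun x : M => TangentSpace 𝓘(ℝ, E) x →L[ℝ] ℝ) α) hd
  have h2 := mfderiv_comp (I := 𝓘(ℝ, E × (E →L[ℝ] ℝ))) (f := (Prod.fst : E × (E →L[ℝ] ℝ) → E))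
    y hd1 (ContinuousLinearMap.fst ℝ E (E →L[ℝ] ℝ)).mdifferentiableAt
  have h3 : mfderiv 𝓘(ℝ, E × (E →L[ℝ] ℝ)) 𝓘(ℝ, E) (Prod.fst : E × (E →L[ℝ] ℝ) → E) y = 
      ContinuousLinearMap.fst ℝ E (E →L[ℝ] ℝ) :=
    (ContinuousLinearMap.fst ℝ E (E →L[ℝ] ℝ)).mfderiv_eq
  have heq : (TotalSpace.proj : CotangentBundle E M → M) ∘ (extChartAt (cotangentModel E) α₀).symm
      =ᶠ[𝓝 y] (extChartAt 𝓘(ℝ, E) α₀.1).symm ∘ Prod.fst := by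
    filter_upwards [(isOpen_extChartAt_target α₀).mem_nhds hy] with z hz
      using proj_extChartAt_cotangent_symm α₀ hz
  have h4 := heq.mfderiv_eq (I := 𝓘(ℝ, E × (E →L[ℝ] ℝ))) (I' := 𝓘(ℝ, E))
  rw [h3] at h2
  have h5 : (mfderiv (cotangentModel E) 𝓘(ℝ, E) (TotalSpace.proj : CotangentBundle E M → M) α
      (mfderivWithin 𝓘(ℝ, E × (E →L[ℝ] ℝ)) (cotangentModel E)
        (extChartAt (cotangentModel E) α₀).symm (Set.range (cotangentModel E)) y (v 0)) : E) =
      mfderivWithin 𝓘(ℝ, E) 𝓘(ℝ, E) (extChartAt 𝓘(ℝ, E) α₀.1).symm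
      (Set.range 𝓘(ℝ, E)) y.1 (v 0).1 := by
    rw [(cotangentModel E).range_eq_univ, (𝓘(ℝ, E)).range_eq_univ, mfderivWithin_univ,
      mfderivWithin_univ]
    exact (DFunLike.congr_fun h1 (v 0)).symm.trans ((DFunLike.congr_fun h4 (v 0)).trans
      (DFunLike.congr_fun h2 (v 0)))
  change g α.1 * α.2 _ = g _ * y.2 (v 0).1
  rw [hy2, ← h5, hproj]
  rfl

theorem isSmoothForm_scaledLiouvilleForm {g : M → ℝ} (hg : ContMDiff 𝓘(ℝ, E) 𝓘(ℝ, ℝ) ∞ g) :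
    IsSmoothForm (scaledLiouvilleForm g : DiffForm (cotangentModel E) (CotangentBundle E M) 1) := by
  intro α₀
  refine ContDiffOn.congr ?_ fun y hy => formInChart_scaledLiouvilleForm g α₀ hy
  have hmaps : Set.MapsTo (Prod.fst : E × (E →L[ℝ] ℝ) → E)
      (extChartAt (cotangentModel E) α₀).target (extChartAt 𝓘(ℝ, E) α₀.1).target := by
    intro y hy
    have h := (extChartAt (cotangentModel E) α₀).map_target hy
    rw [← (extChartAt (cotangentModel E) α₀).right_inv hy, extChartAt_cotangent_fst]
    exact (extChartAt 𝓘(ℝ, E) α₀.1).map_source (mem_extChartAt_cotangent_source.1 h)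
  have h1 : ContDiffOn ℝ ∞ (g ∘ (extChartAt 𝓘(ℝ, E) α₀.1).symm) (extChartAt 𝓘(ℝ, E) α₀.1).target :=
    (hg.comp_contMDiffOn (contMDiffOn_extChartAt_symm α₀.1)).contDiffOn
  have h2 : ContDiffOn ℝ ∞ (fun y : E × (E →L[ℝ] ℝ) =>
      (g ((extChartAt 𝓘(ℝ, E) α₀.1).symm y.1) • y.2).comp (ContinuousLinearMap.fst ℝ E (E →L[ℝ] ℝ)))
      (extChartAt (cotangentModel E) α₀).target :=
    ((h1.comp contDiff_fst.contDiffOn hmaps).smul contDiff_snd.contDiffOn).clm_comp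
      contDiffOn_const
  exact contDiff_ofSubsingleton.comp_contDiffOn h2

/-- This is `d(gλ) = g dλ + dg ∧ λ`, evaluated at the centre of the chart around `α`, where the
fibre coordinate is `α` itself. -/
theorem mextDeriv_scaledLiouvilleForm {g : M → ℝ} (hg : ContMDiff 𝓘(ℝ, E) 𝓘(ℝ, ℝ) ∞ g)
    (α : CotangentBundle E M) (U V : E × (E →L[ℝ] ℝ)) :
    mextDeriv (scaledLiouvilleForm g) α ![U, V] =
      g α.1 * (U.2 V.1 - V.2 U.1) + dirDeriv 𝓘(ℝ, E) g α.1 U.1 * α.2 V.1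
        - dirDeriv 𝓘(ℝ, E) g α.1 V.1 * α.2 U.1 := by
  set y₀ := extChartAt (cotangentModel E) α α with hy₀
  have hn : (extChartAt (cotangentModel E) α).target ∈ 𝓝 y₀ :=
    (isOpen_extChartAt_target α).mem_nhds (mem_extChartAt_target α)
  have hd : DifferentiableAt ℝ (formInChart (scaledLiouvilleForm g) α) y₀ :=
    ((isSmoothForm_scaledLiouvilleForm hg α).contDiffAt hn).differentiableAt (by simp)
  have hy1 : y₀.1 = extChartAt 𝓘(ℝ, E) α.1 α.1 := extChartAt_cotangent_fst α α
  have hy2 : y₀.2 = α.2 := (extChartAt_cotangent_snd α α).trans (trivializationAt_cotangent_self α)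
  have hg1 : HasFDerivAt (g ∘ (extChartAt 𝓘(ℝ, E) α.1).symm)
      (show E →L[ℝ] ℝ from mfderiv 𝓘(ℝ, E) 𝓘(ℝ, ℝ) g α.1) y₀.1 := by
    rw [hy1]
    exact (hg.mdifferentiableAt (x := α.1) (by simp)).hasFDerivAt_comp_extChartAt_symm
  have hfd (w : E × (E →L[ℝ] ℝ)) (z : E × (E →L[ℝ] ℝ)) : fderiv ℝ (fun y =>
      formInChart (scaledLiouvilleForm g) α y ![w]) y₀ z =
        g α.1 * z.2 w.1 + dirDeriv 𝓘(ℝ, E) g α.1 z.1 * α.2 w.1 := by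
    have heq : (fun y => formInChart (scaledLiouvilleForm g) α y ![w]) =ᶠ[𝓝 y₀] fun y =>
        (g ∘ (extChartAt 𝓘(ℝ, E) α.1).symm) y.1 * y.2 w.1 := by
      filter_upwards [hn] with y hy
      rw [formInChart_scaledLiouvilleForm g α hy]
      rfl
    have h1 : HasFDerivAt (fun y : E × (E →L[ℝ] ℝ) =>
        (g ∘ (extChartAt 𝓘(ℝ, E) α.1).symm) y.1 * y.2 w.1) _ y₀ :=
      (hg1.comp y₀ hasFDerivAt_fst).mul
        ((hasFDerivAt_snd (p := y₀)).clm_apply (hasFDerivAt_const w.1 y₀))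
    have hb : (extChartAt 𝓘(ℝ, E) α.1).symm y₀.1 = α.1 := by rw [hy1, extChartAt_to_inv]
    refine (congrArg (fun L => L z) (heq.fderiv_eq.trans h1.fderiv)).trans ?_
    change g ((extChartAt 𝓘(ℝ, E) α.1).symm y₀.1) * (y₀.2 0 + z.2 w.1) +
      y₀.2 w.1 * dirDeriv 𝓘(ℝ, E) g α.1 z.1 = _
    have h0 : y₀.2 0 = 0 := map_zero _
    rw [h0, hb, zero_add, mul_comm (y₀.2 w.1), hy2]
    rfl
  refine (mextDeriv_apply_self _ α ![U, V]).trans ?_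
  -- For a 1-form on a vector space, `dη(U, V)` is the derivative of `η(V)` along `U` minus that of
  -- `η(U)` along `V`; these are the two terms of the alternating sum.
  have hr0 : (0 : Fin 2).removeNth ![U, V] = ![V] := by
    funext i; fin_cases i; rfl
  have hr1 : (1 : Fin 2).removeNth ![U, V] = ![U] := by
    funext i; fin_cases i; rfl
  rw [extDeriv_apply hd, Fin.sum_univ_two, hr0, hr1, hfd, hfd]
  simp
  ring

end Cotangent

/-! ### The symplectic form `-d(exp(φ) λ)`. -/

section ConformalForm

/-- Finite-dimensional spaces are reflexive. -/
theorem exists_forall_apply_eq {V : Type*} [NormedAddCommGroup V] [NormedSpace ℝ V]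
    [FiniteDimensional ℝ V] (ℓ : (V →L[ℝ] ℝ) →ₗ[ℝ] ℝ) : ∃ v, ∀ w : V →L[ℝ] ℝ, ℓ w = w v := by
  let T : Module.Dual ℝ V ≃ₗ[ℝ] (V →L[ℝ] ℝ) := LinearMap.toContinuousLinearMap
  obtain ⟨v, hv⟩ := (Module.evalEquiv ℝ V).surjective (ℓ ∘ₗ T.toLinearMap)
  refine ⟨v, fun w => ?_⟩
  have h := DFunLike.congr_fun hv (T.symm w)
  have h2 : ℓ (T (T.symm w)) = (T.symm w) v := h.symm
  rw [T.apply_symm_apply] at h2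
  exact h2

theorem eq_of_forall_clm_apply_eq {V : Type*} [NormedAddCommGroup V] [NormedSpace ℝ V]
    {u v : V} (h : ∀ w : V →L[ℝ] ℝ, w u = w v) : u = v :=
  (SeparatingDual.eq_iff_forall_dual_eq (R := ℝ)).2 h

variable {E : Type*} [NormedAddCommGroup E] [NormedSpace ℝ E]
  {M : Type*} [TopologicalSpace M] [ChartedSpace E M] [IsManifold 𝓘(ℝ, E) ∞ M]

theorem canonicalForm_apply (α : CotangentBundle E M) (U V : E × (E →L[ℝ] ℝ)) :
    canonicalForm α ![U, V] = V.2 U.1 - U.2 V.1 := by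
  change -(mextDeriv liouvilleForm α ![U, V]) = _
  have h := mextDeriv_scaledLiouvilleForm (g := fun _ : M => (1 : ℝ)) contMDiff_const α U V
  rw [← liouvilleForm_eq_scaledLiouvilleForm] at h
  have h0 (w : E) : dirDeriv 𝓘(ℝ, E) (fun _ : M => (1 : ℝ)) α.1 w = 0 :=
    DFunLike.congr_fun (mfderiv_const (I := 𝓘(ℝ, E)) (I' := 𝓘(ℝ, ℝ)) (x := α.1) (c := (1 : ℝ))) w
  rw [h, h0, h0]
  ring

/-- Vertical test vectors `(0, w)` detect the base component of `U`, and the vectors `(v, 0)` its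
fibre component. -/
theorem canonicalForm_nondegenerate (α : CotangentBundle E M)
    (U : TangentSpace (cotangentModel E) α) (hU : ∀ V, canonicalForm α ![U, V] = 0) : U = 0 := by
  have h (V : E × (E →L[ℝ] ℝ)) := (canonicalForm_apply α U V).symm.trans (hU V)
  have h1 : (show E × (E →L[ℝ] ℝ) from U).1 = 0 := eq_of_forall_clm_apply_eq fun w => by
    simpa using h (0, w)
  have h2 : (show E × (E →L[ℝ] ℝ) from U).2 = 0 := by
    ext v
    simpa using h (v, 0)
  exact Prod.ext h1 h2

/-- The form `-d(exp(φ) λ)` on the cotangent bundle. -/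
def conformalForm (φ : M → ℝ) : DiffForm (cotangentModel E) (CotangentBundle E M) 2 :=
  mextDeriv (scaledLiouvilleForm fun x => -Real.exp (φ x))

theorem conformalForm_apply {φ : M → ℝ} (hφ : ContMDiff 𝓘(ℝ, E) 𝓘(ℝ, ℝ) ∞ φ)
    (α : CotangentBundle E M) (U V : E × (E →L[ℝ] ℝ)) :
    conformalForm φ α ![U, V] = Real.exp (φ α.1) * (V.2 U.1 - U.2 V.1 +
      (dirDeriv 𝓘(ℝ, E) φ α.1 V.1 * α.2 U.1 - dirDeriv 𝓘(ℝ, E) φ α.1 U.1 * α.2 V.1)) := by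
  have hexp : ContMDiff 𝓘(ℝ, E) 𝓘(ℝ, ℝ) ∞ fun x => Real.exp (φ x) :=
    Real.contDiff_exp.contMDiff.comp hφ
  have hd (w : E) : dirDeriv 𝓘(ℝ, E) (fun x => -Real.exp (φ x)) α.1 w =
      -(Real.exp (φ α.1) * dirDeriv 𝓘(ℝ, E) φ α.1 w) := by
    have h1 : HasDerivAt (fun t : ℝ => -Real.exp t) (-Real.exp (φ α.1)) (φ α.1) :=
      (Real.hasDerivAt_exp _).neg
    have h := mfderiv_comp α.1 (I'' := 𝓘(ℝ, ℝ)) (I' := 𝓘(ℝ, ℝ)) (g := fun t : ℝ => -Real.exp t)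
      h1.differentiableAt.mdifferentiableAt (hφ.mdifferentiableAt (x := α.1) (by simp))
    rw [mfderiv_eq_fderiv] at h
    refine (DFunLike.congr_fun h w).trans ?_
    change fderiv ℝ (fun t : ℝ => -Real.exp t) (φ α.1) (dirDeriv 𝓘(ℝ, E) φ α.1 w) = _
    rw [fderiv_eq_smul_deriv, h1.deriv, smul_eq_mul]
    ring
  refine (mextDeriv_scaledLiouvilleForm hexp.neg α U V).trans ?_
  rw [hd, hd]
  ring

/-- Closedness is `d ∘ d = 0`. For non-degeneracy, the extra term `λ ∧ dφ` vanishes on vertical test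
vectors, which already force the base component of `U` to be zero; the extra term then vanishes
altogether, and the canonical argument concludes. -/
theorem isSymplecticForm_conformalForm {φ : M → ℝ} (hφ : ContMDiff 𝓘(ℝ, E) 𝓘(ℝ, ℝ) ∞ φ) :
    IsSymplecticForm (conformalForm φ : DiffForm (cotangentModel E) (CotangentBundle E M) 2) := by
  have hexp : ContMDiff 𝓘(ℝ, E) 𝓘(ℝ, ℝ) ∞ fun x => -Real.exp (φ x) :=
    Real.contDiff_exp.neg.contMDiff.comp hφ
  have hs := isSmoothForm_scaledLiouvilleForm hexp
  refine ⟨hs.mextDeriv, mextDeriv_mextDeriv hs, fun α U hU => ?_⟩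
  have h (V : E × (E →L[ℝ] ℝ)) := (mul_eq_zero.1 ((conformalForm_apply hφ α U V).symm.trans
    (hU V))).resolve_left (Real.exp_pos _).ne'
  have h1 : (show E × (E →L[ℝ] ℝ) from U).1 = 0 := eq_of_forall_clm_apply_eq fun w => by
    have h3 := h (0, w)
    have h0 : dirDeriv 𝓘(ℝ, E) φ α.1 (0 : E) = 0 := map_zero _
    have h0' : α.2 (0 : E) = 0 := map_zero _
    simpa [h0, h0'] using h3
  have h2 : (show E × (E →L[ℝ] ℝ) from U).2 = 0 := by
    ext v
    have h3 := h (v, 0)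
    change (0 : E →L[ℝ] ℝ) _ - (show E × (E →L[ℝ] ℝ) from U).2 v + (_ * α.2
      (show E × (E →L[ℝ] ℝ) from U).1 - dirDeriv 𝓘(ℝ, E) φ α.1
      (show E × (E →L[ℝ] ℝ) from U).1 * _) = 0 at h3
    have h0 : dirDeriv 𝓘(ℝ, E) φ α.1 (0 : E) = 0 := map_zero _
    have h0' : α.2 (0 : E) = 0 := map_zero _
    rw [h1, h0, h0'] at h3
    simpa using h3
  exact Prod.ext h1 h2

end ConformalForm

/-! ### Derivatives of charts as maps of model spaces. -/

section ChartDeriv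

variable {E : Type*} [NormedAddCommGroup E] [NormedSpace ℝ E]
  {M : Type*} [TopologicalSpace M] [ChartedSpace E M]

/-- The derivative at `x` of the preferred chart around `x₀`, as a map of model spaces. -/
def chartDeriv (x₀ x : M) : E →L[ℝ] E :=
  mfderiv 𝓘(ℝ, E) 𝓘(ℝ, E) (extChartAt 𝓘(ℝ, E) x₀) x

/-- The inverse of `chartDeriv`. -/
def chartDerivSymm (x₀ x : M) : E →L[ℝ] E :=
  mfderivWithin 𝓘(ℝ, E) 𝓘(ℝ, E) (extChartAt 𝓘(ℝ, E) x₀).symm (Set.range 𝓘(ℝ, E))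
    (extChartAt 𝓘(ℝ, E) x₀ x)

variable [IsManifold 𝓘(ℝ, E) ∞ M]

theorem chartDerivSymm_chartDeriv {x₀ x : M} (hx : x ∈ (extChartAt 𝓘(ℝ, E) x₀).source) (v : E) :
    chartDerivSymm x₀ x (chartDeriv x₀ x v) = v := by
  have : IsManifold 𝓘(ℝ, E) 1 M := IsManifold.of_le (n := ∞) (by simp)
  exact DFunLike.congr_fun
    (mfderivWithin_extChartAt_symm_comp_mfderiv_extChartAt' (I := 𝓘(ℝ, E)) hx) v

theorem chartDeriv_chartDerivSymm {x₀ x : M} (hx : x ∈ (extChartAt 𝓘(ℝ, E) x₀).source) (v : E) :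
    chartDeriv x₀ x (chartDerivSymm x₀ x v) = v := by
  have : IsManifold 𝓘(ℝ, E) 1 M := IsManifold.of_le (n := ∞) (by simp)
  exact DFunLike.congr_fun
    (mfderiv_extChartAt_comp_mfderivWithin_extChartAt_symm' (I := 𝓘(ℝ, E)) hx) v

@[simp]
theorem chartDeriv_self (x : M) (v : E) : chartDeriv x x v = v := by
  have : IsManifold 𝓘(ℝ, E) 1 M := IsManifold.of_le (n := ∞) (by simp)
  exact DFunLike.congr_fun (mfderiv_extChartAt_self (I := 𝓘(ℝ, E)) (x := x)) v

@[simp]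
theorem chartDerivSymm_self (x : M) (v : E) : chartDerivSymm x x v = v := by
  have : IsManifold 𝓘(ℝ, E) 1 M := IsManifold.of_le (n := ∞) (by simp)
  exact DFunLike.congr_fun (mfderivWithin_range_extChartAt_symm (I := 𝓘(ℝ, E)) (x := x)) v

theorem trivializationAt_tangent_eq_chartDeriv {x₀ x : M}
    (hx : x ∈ (extChartAt 𝓘(ℝ, E) x₀).source) (v : TangentSpace 𝓘(ℝ, E) x) :
    (trivializationAt E (TangentSpace 𝓘(ℝ, E) : M → Type _) x₀ ⟨x, v⟩).2 =
      chartDeriv (E := E) x₀ x v := by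
  have : IsManifold 𝓘(ℝ, E) 1 M := IsManifold.of_le (n := ∞) (by simp)
  exact trivializationAt_tangentSpace_apply hx v

theorem trivializationAt_cotangent_eq_comp {x₀ : M} {α : CotangentBundle E M}
    (hx : α.1 ∈ (extChartAt 𝓘(ℝ, E) x₀).source) :
    (trivializationAt (E →L[ℝ] ℝ) (fun x : M => TangentSpace 𝓘(ℝ, E) x →L[ℝ] ℝ) x₀ α).2 =
      (show E →L[ℝ] ℝ from α.2).comp (chartDerivSymm x₀ α.1) := by
  ext v
  exact trivializationAt_cotangent_apply hx α.2 v

theorem extend_eq_chartDerivSymm {x₀ x : M} (hx : x ∈ (extChartAt 𝓘(ℝ, E) x₀).source)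
    (v : TangentSpace 𝓘(ℝ, E) x₀) :
    FiberBundle.extend E v x = (show TangentSpace 𝓘(ℝ, E) x from chartDerivSymm (E := E) x₀ x v) := by
  have : IsManifold 𝓘(ℝ, E) 1 M := IsManifold.of_le (n := ∞) (by simp)
  have hx' : x ∈ (chartAt E x₀).source := by simpa using hx
  have h1 : (trivializationAt E (TangentSpace 𝓘(ℝ, E) : M → Type _) x₀ ⟨x₀, v⟩).2 = v :=
    (trivializationAt_tangent_eq_chartDeriv (mem_extChartAt_source x₀) v).trans
      (chartDeriv_self (E := E) x₀ v)
  have h2 := DFunLike.congr_fun (TangentBundle.symmL_trivializationAt (I := 𝓘(ℝ, E)) hx') v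
  change (trivializationAt E (TangentSpace 𝓘(ℝ, E) : M → Type _) x₀).symm x
    (trivializationAt E (TangentSpace 𝓘(ℝ, E) : M → Type _) x₀ ⟨x₀, v⟩).2 = _
  rw [h1]
  exact ((trivializationAt E (TangentSpace 𝓘(ℝ, E) : M → Type _) x₀).symmL_apply
    (R := ℝ) (b := x) hx' v).symm.trans h2

end ChartDeriv

section

variable {E : Type*} [NormedAddCommGroup E] [NormedSpace ℝ E] {H : Type*} [TopologicalSpace H]
  {M : Type*} [TopologicalSpace M] [ChartedSpace H M] {I : ModelWithCorners ℝ E H} [I.Boundaryless]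
  {F₁ F₂ F₃ : Type*} [NormedAddCommGroup F₁] [NormedSpace ℝ F₁] [NormedAddCommGroup F₂]
  [NormedSpace ℝ F₂] [NormedAddCommGroup F₃] [NormedSpace ℝ F₃]

/-- The Leibniz rule for compositions of linear maps. -/
theorem mfderiv_clm_comp_apply {g : M → F₂ →L[ℝ] F₃} {f : M → F₁ →L[ℝ] F₂} {x : M}
    (hg : MDifferentiableAt I 𝓘(ℝ, F₂ →L[ℝ] F₃) g x)
    (hf : MDifferentiableAt I 𝓘(ℝ, F₁ →L[ℝ] F₂) f x) (v : TangentSpace I x) :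
    (mfderiv I 𝓘(ℝ, F₁ →L[ℝ] F₃) (fun y => (g y).comp (f y)) x v : F₁ →L[ℝ] F₃) =
      (g x).comp (mfderiv I 𝓘(ℝ, F₁ →L[ℝ] F₂) f x v : F₁ →L[ℝ] F₂) +
        (mfderiv I 𝓘(ℝ, F₂ →L[ℝ] F₃) g x v : F₂ →L[ℝ] F₃).comp (f x) := by
  have hx : (extChartAt I x).symm (extChartAt I x x) = x := extChartAt_to_inv x
  have h1 := hg.hasFDerivAt_comp_extChartAt_symm.clm_comp hf.hasFDerivAt_comp_extChartAt_symm
  have h2 := (hg.clm_comp hf).hasFDerivAt_comp_extChartAt_symm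
  have h3 := DFunLike.congr_fun (h2.unique h1) v
  refine h3.trans ?_
  change (g ((extChartAt I x).symm (extChartAt I x x))).comp _ +
    (mfderiv I 𝓘(ℝ, F₂ →L[ℝ] F₃) g x v : F₂ →L[ℝ] F₃).comp
      (f ((extChartAt I x).symm (extChartAt I x x))) = _
  rw [hx]
  rfl

end

theorem NonholonomicSystem.proj_coe {E Q : Type*} [NormedAddCommGroup E] [NormedSpace ℝ E]
    [FiniteDimensional ℝ E] [TopologicalSpace Q] [ChartedSpace E Q] [IsManifold 𝓘(ℝ, E) ∞ Q] {r : ℕ}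
    (N : NonholonomicSystem E Q r) (q : Q) (v : N.D q) : N.proj q v = v :=
  Submodule.projectionOnto_apply_left (N.isCompl_D_orthD q) v

theorem ContinuousLinearMap.isInvertible_of_pos {V : Type*} [NormedAddCommGroup V]
    [NormedSpace ℝ V] [FiniteDimensional ℝ V] {B : V →L[ℝ] V →L[ℝ] ℝ}
    (hB : ∀ u, u ≠ 0 → 0 < B u u) : B.IsInvertible := by
  refine ContinuousLinearMap.isInvertible_of_injective ?_ ?_
  · rw [← (LinearMap.toContinuousLinearMap (𝕜 := ℝ) (E := V) (F' := ℝ)).finrank_eq]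
    exact (Subspace.dual_finrank_eq (K := ℝ) (V := V)).symm
  · refine (injective_iff_map_eq_zero _).2 fun u hu => ?_
    by_contra hne
    exact (hB u hne).ne' (DFunLike.congr_fun hu u)

theorem ContinuousLinearMap.IsInvertible.inverse_eq {V W : Type*} [NormedAddCommGroup V]
    [NormedSpace ℝ V] [NormedAddCommGroup W] [NormedSpace ℝ W] {B : V →L[ℝ] W}
    (hB : B.IsInvertible) {v : V} {w : W} (h : B v = w) : B.inverse w = v := by
  obtain ⟨e, rfl⟩ := hB
  rw [← h, ContinuousLinearMap.inverse_equiv]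
  exact e.symm_apply_apply v

theorem ContinuousLinearMap.IsInvertible.apply_inverse {V W : Type*} [NormedAddCommGroup V]
    [NormedSpace ℝ V] [NormedAddCommGroup W] [NormedSpace ℝ W] {B : V →L[ℝ] W}
    (hB : B.IsInvertible) (w : W) : B (B.inverse w) = w := by
  obtain ⟨e, rfl⟩ := hB
  rw [ContinuousLinearMap.inverse_equiv]
  exact e.apply_symm_apply w

/-! ### Lie brackets in charts, and fields that are constant in a chart. -/

section LieBracket

variable {E : Type*} [NormedAddCommGroup E] [NormedSpace ℝ E]
  {M : Type*} [TopologicalSpace M] [ChartedSpace E M] [IsManifold 𝓘(ℝ, E) ∞ M]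

/-- The pull-back by the inverse chart applies the inverse of that chart's derivative, which is
`chartDeriv`. Thus `A` is the coordinate expression of `V`. -/
theorem eventually_mpullbackWithin_eq {V : ∀ y : M, TangentSpace 𝓘(ℝ, E) y} {A : M → E} {x : M}
    (hVA : ∀ᶠ y in 𝓝 x, chartDeriv (E := E) x y (V y) = A y) :
    VectorField.mpullbackWithin 𝓘(ℝ, E) 𝓘(ℝ, E) (extChartAt 𝓘(ℝ, E) x).symm V
      (Set.range 𝓘(ℝ, E)) =ᶠ[𝓝 (extChartAt 𝓘(ℝ, E) x x)] A ∘ (extChartAt 𝓘(ℝ, E) x).symm := by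
  let V' : M → E := V
  have key : ∀ᶠ y in 𝓝 x, (chartDerivSymm x y).inverse
      (V' ((extChartAt 𝓘(ℝ, E) x).symm (extChartAt 𝓘(ℝ, E) x y))) = A y := by
    filter_upwards [hVA, (isOpen_extChartAt_source x).mem_nhds
      (mem_extChartAt_source (I := 𝓘(ℝ, E)) x)] with y h1 h2
    rw [(extChartAt 𝓘(ℝ, E) x).left_inv h2, ← h1]
    have hinv : (chartDerivSymm x y : E →L[ℝ] E).IsInvertible :=
      ContinuousLinearMap.IsInvertible.of_inverse (g := chartDeriv x y)
        (ContinuousLinearMap.ext (chartDerivSymm_chartDeriv h2))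
        (ContinuousLinearMap.ext (chartDeriv_chartDerivSymm h2))
    exact hinv.inverse_eq (chartDerivSymm_chartDeriv h2 _)
  have hcont := (continuousAt_extChartAt_symm (I := 𝓘(ℝ, E)) x).tendsto
  rw [extChartAt_to_inv] at hcont
  filter_upwards [hcont.eventually key, (isOpen_extChartAt_target x).mem_nhds
    (mem_extChartAt_target (I := 𝓘(ℝ, E)) x)] with y h1 h2
  change (show E →L[ℝ] E from mfderivWithin 𝓘(ℝ, E) 𝓘(ℝ, E) (extChartAt 𝓘(ℝ, E) x).symm
    (Set.range 𝓘(ℝ, E)) y).inverse (V' ((extChartAt 𝓘(ℝ, E) x).symm y)) = _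
  refine Eq.trans ?_ h1
  unfold chartDerivSymm
  rw [(extChartAt 𝓘(ℝ, E) x).right_inv h2]

/-- The Lie bracket in a chart. -/
theorem mlieBracket_eq_of_chartDeriv {V W : ∀ y : M, TangentSpace 𝓘(ℝ, E) y} {A B : M → E} {x : M}
    (hA : MDifferentiableAt 𝓘(ℝ, E) 𝓘(ℝ, E) A x) (hB : MDifferentiableAt 𝓘(ℝ, E) 𝓘(ℝ, E) B x)
    (hVA : ∀ᶠ y in 𝓝 x, chartDeriv (E := E) x y (V y) = A y)
    (hWB : ∀ᶠ y in 𝓝 x, chartDeriv (E := E) x y (W y) = B y) :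
    (VectorField.mlieBracket 𝓘(ℝ, E) V W x : E) =
      (show E →L[ℝ] E from mfderiv 𝓘(ℝ, E) 𝓘(ℝ, E) B x) (V x) -
        (show E →L[ℝ] E from mfderiv 𝓘(ℝ, E) 𝓘(ℝ, E) A x) (W x) := by
  have : IsManifold 𝓘(ℝ, E) 1 M := IsManifold.of_le (n := ∞) (by simp)
  have hy : (extChartAt 𝓘(ℝ, E) x).symm (extChartAt 𝓘(ℝ, E) x x) = x := extChartAt_to_inv x
  let V' : E → E := VectorField.mpullbackWithin 𝓘(ℝ, E) 𝓘(ℝ, E) (extChartAt 𝓘(ℝ, E) x).symm V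
    (Set.range 𝓘(ℝ, E))
  let W' : E → E := VectorField.mpullbackWithin 𝓘(ℝ, E) 𝓘(ℝ, E) (extChartAt 𝓘(ℝ, E) x).symm W
    (Set.range 𝓘(ℝ, E))
  have hV' : V' =ᶠ[𝓝 (extChartAt 𝓘(ℝ, E) x x)] A ∘ (extChartAt 𝓘(ℝ, E) x).symm :=
    eventually_mpullbackWithin_eq hVA
  have hW' : W' =ᶠ[𝓝 (extChartAt 𝓘(ℝ, E) x x)] B ∘ (extChartAt 𝓘(ℝ, E) x).symm :=
    eventually_mpullbackWithin_eq hWB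
  have h1 : (VectorField.mlieBracket 𝓘(ℝ, E) V W x : E) =
      (chartDeriv x x).inverse (VectorField.lieBracketWithin ℝ V' W'
        ((extChartAt 𝓘(ℝ, E) x).symm ⁻¹' Set.univ ∩ Set.range 𝓘(ℝ, E))
        (extChartAt 𝓘(ℝ, E) x x)) :=
    congrFun (VectorField.mlieBracketWithin_univ (I := 𝓘(ℝ, E)) (V := V) (W := W)).symm x
  clear_value V' W'
  have hid : (chartDeriv x x : E →L[ℝ] E) = ContinuousLinearMap.id ℝ E :=
    ContinuousLinearMap.ext (chartDeriv_self x)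
  have hset : (extChartAt 𝓘(ℝ, E) x).symm ⁻¹' Set.univ ∩ Set.range 𝓘(ℝ, E) = Set.univ := by simp
  have hV0 : (V x : E) = A x := (chartDeriv_self (E := E) x (V x)).symm.trans hVA.self_of_nhds
  have hW0 : (W x : E) = B x := (chartDeriv_self (E := E) x (W x)).symm.trans hWB.self_of_nhds
  rw [hid, hset, ContinuousLinearMap.inverse_id, VectorField.lieBracketWithin_univ] at h1
  refine h1.trans ((hV'.lieBracket_vectorField_eq hW').trans ?_)
  rw [VectorField.lieBracket, hA.hasFDerivAt_comp_extChartAt_symm.fderiv,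
    hB.hasFDerivAt_comp_extChartAt_symm.fderiv, Function.comp_apply, Function.comp_apply, hy,
    ← hV0, ← hW0]

theorem eventually_chartDeriv_extend (x : M) (v : E) :
    ∀ᶠ y in 𝓝 x, chartDeriv (E := E) x y
      (FiberBundle.extend E (show TangentSpace 𝓘(ℝ, E) x from v) y) = v := by
  filter_upwards [(isOpen_extChartAt_source x).mem_nhds
    (mem_extChartAt_source (I := 𝓘(ℝ, E)) x)] with y hy
  rw [extend_eq_chartDerivSymm hy]
  exact chartDeriv_chartDerivSymm hy v

/-- Both fields are constant in the same chart, so their bracket vanishes. -/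
theorem mlieBracket_extend (x : M) (u v : TangentSpace 𝓘(ℝ, E) x) :
    VectorField.mlieBracket 𝓘(ℝ, E) (FiberBundle.extend E u) (FiberBundle.extend E v) x = 0 := by
  have h0 (c w : E) :
      (show E →L[ℝ] E from mfderiv 𝓘(ℝ, E) 𝓘(ℝ, E) (fun _ : M => c) x) w = 0 :=
    DFunLike.congr_fun (mfderiv_const (I := 𝓘(ℝ, E)) (I' := 𝓘(ℝ, E)) (x := x) (c := c)) w
  refine (mlieBracket_eq_of_chartDeriv (A := fun _ => (show E from u)) (B := fun _ => (show E from v))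
    mdifferentiableAt_const mdifferentiableAt_const (eventually_chartDeriv_extend (E := E) x u)
    (eventually_chartDeriv_extend (E := E) x v)).trans ?_
  exact (congrArg₂ (· - ·) (h0 _ _) (h0 _ _)).trans (sub_zero (0 : E))

/-- Every tangent vector extends to a smooth vector field that agrees near the base point with the
field that is constant in the preferred chart. -/
theorem exists_isSmoothField_eventuallyEq_extend [T2Space M] [FiniteDimensional ℝ E]
    [IsManifold 𝓘(ℝ, E) 1 M] (x : M)
    (v : TangentSpace 𝓘(ℝ, E) x) : ∃ Y : ∀ y : M, TangentSpace 𝓘(ℝ, E) y,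
      IsSmoothField 𝓘(ℝ, E) Y ∧ ∀ᶠ y in 𝓝 x, Y y = FiberBundle.extend E v y := by
  obtain ⟨χ⟩ : Nonempty (SmoothBumpFunction 𝓘(ℝ, E) x) := inferInstance
  refine ⟨(χ : M → ℝ) • FiberBundle.extend E v, ?_, ?_⟩
  · refine ContMDiffOn.smul_section_of_tsupport (χ.contMDiff.contMDiffOn)
      (chartAt E x).open_source χ.tsupport_subset_chartAt_source ?_
    intro y hy
    rw [(trivializationAt E (TangentSpace 𝓘(ℝ, E) : M → Type _) x).contMDiffWithinAt_section _ hy]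
    refine (contMDiffOn_const (c := (show E from v)) y hy).congr_of_mem (fun z hz => ?_) hy
    have hz' : z ∈ (extChartAt 𝓘(ℝ, E) x).source := by simpa using hz
    refine (trivializationAt_tangent_eq_chartDeriv hz' _).trans ?_
    rw [extend_eq_chartDerivSymm hz']
    exact chartDeriv_chartDerivSymm hz' v
  · filter_upwards [χ.eventuallyEq_one] with y hy
    rw [Pi.smul_apply', hy]
    exact one_smul ℝ _

end LieBracket

theorem isInvertible_mfderiv_smul {E Q : Type*} (EG : Type*) {G : Type*} [NormedAddCommGroup E]
    [NormedSpace ℝ E] [TopologicalSpace Q] [ChartedSpace E Q]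
    [NormedAddCommGroup EG] [NormedSpace ℝ EG] [Group G] [TopologicalSpace G] [ChartedSpace EG G]
    [MulAction G Q] [ContMDiffSMul 𝓘(ℝ, EG) 𝓘(ℝ, E) ∞ G Q] (g : G) (q : Q) :
    (mfderiv 𝓘(ℝ, E) 𝓘(ℝ, E) (fun p : Q => g • p) q).IsInvertible :=
  ⟨(Diffeomorph.smul (I := 𝓘(ℝ, EG)) (I' := 𝓘(ℝ, E)) (n := ∞) (M := Q) g
    ).mfderivToContinuousLinearEquiv (by simp) q, rfl⟩

theorem contMDiffAt_cotangentTrivialization {E M : Type*} [NormedAddCommGroup E] [NormedSpace ℝ E]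
    [TopologicalSpace M] [ChartedSpace E M] [IsManifold 𝓘(ℝ, E) ∞ M] (α : CotangentBundle E M) :
    ContMDiffAt (cotangentModel E) 𝓘(ℝ, E →L[ℝ] ℝ) ∞ (fun a : CotangentBundle E M =>
      (trivializationAt (E →L[ℝ] ℝ) (fun x : M => TangentSpace 𝓘(ℝ, E) x →L[ℝ] ℝ) α.1 a).2) α :=
  (Bundle.contMDiffAt_totalSpace.1 (contMDiffAt_id (x := α))).2

theorem contMDiff_cotangentProj {E M : Type*} [NormedAddCommGroup E] [NormedSpace ℝ E]
    [TopologicalSpace M] [ChartedSpace E M] [IsManifold 𝓘(ℝ, E) ∞ M] :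
    ContMDiff (cotangentModel E) 𝓘(ℝ, E) ∞ (TotalSpace.proj : CotangentBundle E M → M) :=
  Bundle.contMDiff_proj _

/-- The vector `g` is the fibre derivative of a function on `T*S` with differential `ℓ`; by
reflexivity it lies in `V` itself. -/
theorem exists_forall_prod_apply_eq {V : Type*} [NormedAddCommGroup V] [NormedSpace ℝ V]
    [FiniteDimensional ℝ V] (ℓ : V × (V →L[ℝ] ℝ) →L[ℝ] ℝ) :
    ∃ g : V, ∀ u w, ℓ (u, w) = ℓ (u, 0) + w g := by
  obtain ⟨g, hg⟩ := exists_forall_apply_eq (V := V)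
    (ℓ.toLinearMap ∘ₗ LinearMap.inr ℝ V (V →L[ℝ] ℝ))
  refine ⟨g, fun u w => ?_⟩
  rw [← hg w]
  refine Eq.trans ?_ (map_add ℓ (u, 0) (0, w))
  simp

/-! ### Horizontal lift and the map `T*Q → T*S`. -/

namespace ChaplyginSystem

set_option linter.unusedSectionVars false

variable {E Q EG G F S : Type*} [NormedAddCommGroup E] [NormedSpace ℝ E] [FiniteDimensional ℝ E]
  [TopologicalSpace Q] [ChartedSpace E Q] [IsManifold 𝓘(ℝ, E) ∞ Q]
  [NormedAddCommGroup EG] [NormedSpace ℝ EG]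
  [Group G] [TopologicalSpace G] [ChartedSpace EG G] [LieGroup 𝓘(ℝ, EG) ∞ G]
  [MulAction G Q] [ContMDiffSMul 𝓘(ℝ, EG) 𝓘(ℝ, E) ∞ G Q] [ProperSMul G Q]
  [NormedAddCommGroup F] [NormedSpace ℝ F] [FiniteDimensional ℝ F]
  [TopologicalSpace S] [ChartedSpace F S] [IsManifold 𝓘(ℝ, F) ∞ S] {r : ℕ}
  (C : ChaplyginSystem E Q EG G F S r)

/-- The derivative of the projection, as a map of model spaces. -/
def dproj (q : Q) : E →L[ℝ] F := mfderiv 𝓘(ℝ, E) 𝓘(ℝ, F) C.shapeProj q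

/-- The horizontal lift, as a map of model spaces. -/
def horMap (q : Q) : F →L[ℝ] E :=
  LinearMap.toContinuousLinearMap (E := F) (F' := E) ((C.D q).subtype ∘ₗ C.horAt q)

theorem horMap_mem (q : Q) (u : F) : C.horMap q u ∈ C.D q := (C.horAt q u).2

@[simp]
theorem dproj_horMap (q : Q) (u : F) : C.dproj q (C.horMap q u) = u :=
  (C.horEquiv q).apply_symm_apply u

theorem horMap_dproj {q : Q} {v : E} (hv : v ∈ C.D q) : C.horMap q (C.dproj q v) = v :=
  congrArg Subtype.val ((C.horEquiv q).symm_apply_apply ⟨v, hv⟩)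

/-- The horizontal lift, read in the charts around `q₀` and `π(q₀)`. -/
def horChart (q₀ q : Q) : F →L[ℝ] E :=
  (chartDeriv q₀ q).comp ((C.horMap q).comp (chartDerivSymm (C.shapeProj q₀) (C.shapeProj q)))

theorem horChart_self (q : Q) : C.horChart q q = C.horMap q := by
  ext u
  simp [horChart]

/-- On a local frame of `D`, let `A c` be the combination of the frame with coefficients `c`, and `B
c` its image by `Tπ`, both read in charts. Then the lift is `A ∘ B⁻¹`, which is smooth because `A`
and `B` are. -/
theorem contMDiffAt_horChart (q₀ : Q) :
    ContMDiffAt 𝓘(ℝ, E) 𝓘(ℝ, F →L[ℝ] E) ∞ (C.horChart q₀) q₀ := by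
  obtain ⟨W, hW, X, hX, hD⟩ := C.smooth_D q₀
  set s₀ := C.shapeProj q₀ with hs₀
  let X' : Fin r → Q → E := X
  have hD' (q : Q) (hq : q ∈ W) (v : E) : v ∈ C.D q ↔ ∃ c : Fin r → ℝ, ∑ i, c i • X' i q = v := by
    rw [hD q hq]
    exact Submodule.mem_span_range_iff_exists_fun (M := TangentSpace 𝓘(ℝ, E) q) ℝ
  let x (i : Fin r) (q : Q) : E := chartDeriv (E := E) q₀ q (X' i q)
  let y (i : Fin r) (q : Q) : F := chartDeriv s₀ (C.shapeProj q) (C.dproj q (X' i q))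
  have hsrc : ∀ᶠ q in 𝓝 q₀, q ∈ (extChartAt 𝓘(ℝ, E) q₀).source :=
    (isOpen_extChartAt_source q₀).mem_nhds (mem_extChartAt_source q₀)
  have hsrc' : ∀ᶠ q in 𝓝 q₀, C.shapeProj q ∈ (extChartAt 𝓘(ℝ, F) s₀).source :=
    C.smooth_shapeProj.continuous.continuousAt.preimage_mem_nhds
      ((isOpen_extChartAt_source s₀).mem_nhds (mem_extChartAt_source s₀))
  have hXat (i : Fin r) : ContMDiffAt 𝓘(ℝ, E) (𝓘(ℝ, E)).tangent ∞
      (fun q => (⟨q, X i q⟩ : TangentBundle 𝓘(ℝ, E) Q)) q₀ := (hX i).contMDiffAt hW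
  have hx (i : Fin r) : ContMDiffAt 𝓘(ℝ, E) 𝓘(ℝ, E) ∞ (x i) q₀ := by
    refine (Bundle.contMDiffAt_totalSpace.1 (hXat i)).2.congr_of_eventuallyEq ?_
    filter_upwards [hsrc] with q hq
    exact (trivializationAt_tangent_eq_chartDeriv hq (X i q)).symm
  have hy (i : Fin r) : ContMDiffAt 𝓘(ℝ, E) 𝓘(ℝ, F) ∞ (y i) q₀ := by
    have h := ((C.smooth_shapeProj.contMDiff_tangentMap (m := ∞) le_rfl).contMDiffAt
      (x := ⟨q₀, X i q₀⟩)).comp q₀ (hXat i)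
    refine (Bundle.contMDiffAt_totalSpace.1 h).2.congr_of_eventuallyEq ?_
    filter_upwards [hsrc'] with q hq
    exact (trivializationAt_tangent_eq_chartDeriv hq _).symm
  let A (q : Q) : (Fin r → ℝ) →L[ℝ] E := ∑ i, (ContinuousLinearMap.proj i).smulRight (x i q)
  let B (q : Q) : (Fin r → ℝ) →L[ℝ] F := ∑ i, (ContinuousLinearMap.proj i).smulRight (y i q)
  have hA : ContMDiffAt 𝓘(ℝ, E) 𝓘(ℝ, (Fin r → ℝ) →L[ℝ] E) ∞ A q₀ := by
    refine contMDiffAt_finsetSum fun i _ => ?_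
    exact (ContinuousLinearMap.smulRightL ℝ (Fin r → ℝ) E
      (ContinuousLinearMap.proj i)).contMDiff.contMDiffAt.comp q₀ (hx i)
  have hB : ContMDiffAt 𝓘(ℝ, E) 𝓘(ℝ, (Fin r → ℝ) →L[ℝ] F) ∞ B q₀ := by
    refine contMDiffAt_finsetSum fun i _ => ?_
    exact (ContinuousLinearMap.smulRightL ℝ (Fin r → ℝ) F
      (ContinuousLinearMap.proj i)).contMDiff.contMDiffAt.comp q₀ (hy i)
  have hAap (q : Q) (c : Fin r → ℝ) :
      A q c = chartDeriv (E := E) q₀ q (∑ i, c i • X' i q) := by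
    simp [A, x]
  have hBap (q : Q) (c : Fin r → ℝ) : B q c = chartDeriv (E := F) s₀ (C.shapeProj q)
      (C.dproj q (∑ i, c i • X' i q)) := by
    simp [B, y]
  -- `B q₀` is onto since each `hor u` is a combination of the frame and projects to `u`; the
  -- dimensions agree because `S` has dimension `r`.
  have hBinv : (B q₀).IsInvertible := by
    have hfin : Module.finrank ℝ (Fin r → ℝ) = Module.finrank ℝ F := by
      rw [C.finrank_shape, Module.finrank_fin_fun]
    refine ContinuousLinearMap.isInvertible_of_injective hfin
      ((LinearMap.injective_iff_surjective_of_finrank_eq_finrank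
        (f := (B q₀).toLinearMap) hfin).2 fun u => ?_)
    obtain ⟨c, hc⟩ := (hD' q₀ (mem_of_mem_nhds hW) _).1 (C.horMap_mem q₀ u)
    refine ⟨c, (hBap q₀ c).trans ?_⟩
    rw [hc, dproj_horMap]
    exact chartDeriv_self s₀ u
  refine (hA.clm_comp (hB.clm_inverse hBinv)).congr_of_eventuallyEq ?_
  filter_upwards [hsrc, hsrc', hW, hB.eventually_isInvertible hBinv] with q h1 h2 hq hi
  obtain ⟨e, he⟩ := hi
  ext u
  obtain ⟨c, rfl⟩ := e.surjective u
  have hmem : (∑ i, c i • X' i q) ∈ C.D q := (hD' q hq _).2 ⟨c, rfl⟩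
  have h3 : e c = B q c := by rw [← he]; rfl
  have h4 : (B q).inverse (e c) = c := by rw [← he]; simp
  rw [ContinuousLinearMap.comp_apply, h4, hAap, h3, hBap]
  change chartDeriv q₀ q (C.horMap q (chartDerivSymm s₀ (C.shapeProj q) _)) = _
  rw [chartDerivSymm_chartDeriv h2, C.horMap_dproj hmem]

/-- The map `α ↦ α ∘ hor` from `T*Q` to `T*S`. -/
def cotangentReduction (α : CotangentBundle E Q) : CotangentBundle F S :=
  ⟨C.shapeProj α.1, (show E →L[ℝ] ℝ from α.2).comp (C.horMap α.1)⟩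

theorem proj_horMap (q : Q) (u : F) : C.proj q (C.horMap q u) = C.horAt q u :=
  C.proj_coe q (C.horAt q u)

/-- Horizontal lifts lie in `D`, where `P` is the identity. -/
theorem cotangentReduction_dualProj (β : C.DualD) :
    C.cotangentReduction (C.dualProj β) = C.reduction β := by
  refine congrArg (fun ℓ => (⟨C.shapeProj β.1, ℓ⟩ : CotangentBundle F S)) ?_
  refine ContinuousLinearMap.ext fun u => congrArg β.2 ?_
  exact C.proj_horMap β.1 u

theorem eventually_trivializationAt_cotangentReduction (α₀ : CotangentBundle E Q) :
    ∀ᶠ α in 𝓝 α₀, (trivializationAt (F →L[ℝ] ℝ)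
      (fun s : S => TangentSpace 𝓘(ℝ, F) s →L[ℝ] ℝ) (C.shapeProj α₀.1)
        (C.cotangentReduction α)).2 =
      (trivializationAt (E →L[ℝ] ℝ) (fun q : Q => TangentSpace 𝓘(ℝ, E) q →L[ℝ] ℝ) α₀.1 α).2.comp
        (C.horChart α₀.1 α.1) := by
  have hc : Continuous (TotalSpace.proj : CotangentBundle E Q → Q) :=
    FiberBundle.continuous_proj (E →L[ℝ] ℝ) _
  filter_upwards [hc.continuousAt.preimage_mem_nhds
      ((isOpen_extChartAt_source α₀.1).mem_nhds (mem_extChartAt_source (I := 𝓘(ℝ, E)) α₀.1)),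
    (C.smooth_shapeProj.continuous.comp hc).continuousAt.preimage_mem_nhds
      ((isOpen_extChartAt_source _).mem_nhds
        (mem_extChartAt_source (I := 𝓘(ℝ, F)) (C.shapeProj α₀.1)))] with α h1 h2
  rw [trivializationAt_cotangent_eq_comp h1, trivializationAt_cotangent_eq_comp
    (α := C.cotangentReduction α) (show C.shapeProj α.1 ∈ _ from h2)]
  ext u
  exact congrArg (show E →L[ℝ] ℝ from α.2) (chartDerivSymm_chartDeriv h1 _).symm

theorem contMDiff_cotangentReduction :
    ContMDiff (cotangentModel E) (cotangentModel F) ∞ C.cotangentReduction := by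
  intro α
  refine Bundle.contMDiffAt_totalSpace.2
    ⟨(C.smooth_shapeProj.comp contMDiff_cotangentProj).contMDiffAt, ?_⟩
  exact ((contMDiffAt_cotangentTrivialization α).clm_comp
    ((C.contMDiffAt_horChart α.1).comp α contMDiff_cotangentProj.contMDiffAt)).congr_of_eventuallyEq
      (C.eventually_trivializationAt_cotangentReduction α)

/-- The derivative of the horizontal lift, read in charts. -/
def dhor (q : Q) : E →L[ℝ] F →L[ℝ] E :=
  mfderiv 𝓘(ℝ, E) 𝓘(ℝ, F →L[ℝ] E) (C.horChart q) q

/-- Differentiate `α ∘ hor` by the Leibniz rule. The term with `dhor`, the variation of the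
horizontal lift with the base point, is what produces the gyroscopic contribution in the brackets.
-/
theorem mfderiv_cotangentReduction (α : CotangentBundle E Q) (V : E × (E →L[ℝ] ℝ)) :
    (mfderiv (cotangentModel E) (cotangentModel F) C.cotangentReduction α V : F × (F →L[ℝ] ℝ)) =
      (C.dproj α.1 V.1, V.2.comp (C.horMap α.1) +
        (show E →L[ℝ] ℝ from α.2).comp (C.dhor α.1 V.1)) := by
  have hρ : MDifferentiableAt (cotangentModel E) (cotangentModel F) C.cotangentReduction α :=
    C.contMDiff_cotangentReduction.mdifferentiableAt (by simp)
  have hπ : MDifferentiableAt (cotangentModel E) 𝓘(ℝ, E)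
      (TotalSpace.proj : CotangentBundle E Q → Q) α :=
    contMDiff_cotangentProj.mdifferentiableAt (by simp)
  have hπS : MDifferentiableAt (cotangentModel F) 𝓘(ℝ, F)
      (TotalSpace.proj : CotangentBundle F S → S) (C.cotangentReduction α) :=
    contMDiff_cotangentProj.mdifferentiableAt (by simp)
  set W : F × (F →L[ℝ] ℝ) :=
    mfderiv (cotangentModel E) (cotangentModel F) C.cotangentReduction α V with hW
  refine Prod.ext ?_ ?_
  · have h1 := DFunLike.congr_fun (mfderiv_comp α hπS hρ) V
    have h2 := DFunLike.congr_fun (mfderiv_comp α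
      (C.smooth_shapeProj.mdifferentiableAt (x := α.1) (by simp)) hπ) V
    have h3 := mfderiv_cotangent_proj (C.cotangentReduction α) W
    have h4 := mfderiv_cotangent_proj α V
    refine h3.symm.trans (h1.symm.trans (h2.trans ?_))
    exact congrArg (C.dproj α.1) h4
  · have hh : MDifferentiableAt 𝓘(ℝ, E) 𝓘(ℝ, F →L[ℝ] E) (C.horChart α.1) α.1 :=
      (C.contMDiffAt_horChart α.1).mdifferentiableAt (by simp)
    have htS : MDifferentiableAt (cotangentModel F) 𝓘(ℝ, F →L[ℝ] ℝ) _ (C.cotangentReduction α) :=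
      (contMDiffAt_cotangentTrivialization (C.cotangentReduction α)).mdifferentiableAt (by simp)
    have ht : MDifferentiableAt (cotangentModel E) 𝓘(ℝ, E →L[ℝ] ℝ) _ α :=
      (contMDiffAt_cotangentTrivialization α).mdifferentiableAt (by simp)
    have h1 := DFunLike.congr_fun (mfderiv_comp α htS hρ) V
    have h2 := mfderiv_cotangent_trivialization (C.cotangentReduction α) W
    have he : (fun a => (trivializationAt (F →L[ℝ] ℝ)
        (fun s : S => TangentSpace 𝓘(ℝ, F) s →L[ℝ] ℝ) (C.shapeProj α.1)
          (C.cotangentReduction a)).2) =ᶠ[𝓝 α] (fun a => (trivializationAt (E →L[ℝ] ℝ)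
        (fun q : Q => TangentSpace 𝓘(ℝ, E) q →L[ℝ] ℝ) α.1 a).2.comp (C.horChart α.1 a.1)) :=
      C.eventually_trivializationAt_cotangentReduction α
    have h3 := DFunLike.congr_fun (he.mfderiv_eq (I := cotangentModel E)
      (I' := 𝓘(ℝ, F →L[ℝ] ℝ))) V
    have h4 := mfderiv_clm_comp_apply ht (hh.comp α hπ) V
    have h5 := DFunLike.congr_fun (mfderiv_comp α hh hπ) V
    have h6 := mfderiv_cotangent_trivialization α V
    have h7 := mfderiv_cotangent_proj α V
    refine h2.symm.trans (h1.symm.trans (h3.trans (h4.trans ?_)))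
    -- At the base point itself the trivialised covector is `α` and `horChart` is `horMap`.
    refine (add_comm _ _).trans (congrArg₂ (· + ·) ?_ ?_)
    · exact congrArg₂ (fun (a : E →L[ℝ] ℝ) (b : F →L[ℝ] E) => a.comp b) h6 (C.horChart_self α.1)
    · exact congrArg₂ (fun (a : E →L[ℝ] ℝ) (b : F →L[ℝ] E) => a.comp b)
        (trivializationAt_cotangent_self α) (h5.trans (congrArg (C.dhor α.1) h7))

/-- Lets objects on `S` that are defined through an arbitrary preimage be computed through a
smoothly varying one. -/
theorem exists_localSection (q₀ : Q) : ∃ σ : S → Q, σ (C.shapeProj q₀) = q₀ ∧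
    ContMDiffAt 𝓘(ℝ, F) 𝓘(ℝ, E) ∞ σ (C.shapeProj q₀) ∧
    ∀ᶠ s in 𝓝 (C.shapeProj q₀), C.shapeProj (σ s) = s := by
  set s₀ := C.shapeProj q₀ with hs₀
  set y₀ := extChartAt 𝓘(ℝ, E) q₀ q₀ with hy₀
  have hy : (extChartAt 𝓘(ℝ, E) q₀).symm y₀ = q₀ := extChartAt_to_inv q₀
  let g : Q → F := extChartAt 𝓘(ℝ, F) s₀ ∘ C.shapeProj
  have hchart : ContMDiffAt 𝓘(ℝ, F) 𝓘(ℝ, F) ∞ (extChartAt 𝓘(ℝ, F) s₀) s₀ :=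
    contMDiffAt_extChartAt
  have hg : ContMDiffAt 𝓘(ℝ, E) 𝓘(ℝ, F) ∞ g q₀ :=
    hchart.comp q₀ C.smooth_shapeProj.contMDiffAt
  have hsymm : ContMDiffAt 𝓘(ℝ, E) 𝓘(ℝ, E) ∞ (extChartAt 𝓘(ℝ, E) q₀).symm y₀ :=
    (contMDiffOn_extChartAt_symm q₀).contMDiffAt
      ((isOpen_extChartAt_target q₀).mem_nhds (mem_extChartAt_target q₀))
  let f : E → F := g ∘ (extChartAt 𝓘(ℝ, E) q₀).symm
  have hf : ContDiffAt ℝ ∞ f y₀ :=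
    (ContMDiffAt.comp y₀ (by rw [hy]; exact hg) hsymm).contDiffAt
  have hf' : HasFDerivAt f (C.dproj q₀) y₀ := by
    refine (hg.mdifferentiableAt (by simp)).hasFDerivAt_comp_extChartAt_symm.congr_fderiv ?_
    ext v
    refine (DFunLike.congr_fun (mfderiv_comp q₀ (hchart.mdifferentiableAt (by simp))
      (C.smooth_shapeProj.mdifferentiableAt (x := q₀) (by simp))) v).trans ?_
    exact chartDeriv_self (E := F) s₀ (C.dproj q₀ v)
  have hn : (∞ : WithTop ℕ∞) ≠ 0 := by simp
  -- Restrict `π` to an affine slice through `q₀` in the horizontal directions. There its derivative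
  -- is `Tπ ∘ hor = id`, so the inverse function theorem applies.
  let ψ : F → E := fun x => y₀ + C.horMap q₀ x
  have hψ0 : ψ 0 = y₀ := by simp [ψ]
  have hψ : ContDiff ℝ ∞ ψ := contDiff_const.add (C.horMap q₀).contDiff
  have hψ' : HasFDerivAt ψ (C.horMap q₀) 0 := (C.horMap q₀).hasFDerivAt.const_add y₀
  have hh : ContDiffAt ℝ ∞ (f ∘ ψ) 0 := ContDiffAt.comp 0 (by rw [hψ0]; exact hf) hψ.contDiffAt
  have hh' : HasFDerivAt (f ∘ ψ) ((ContinuousLinearEquiv.refl ℝ F : F ≃L[ℝ] F) : F →L[ℝ] F) 0 := by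
    refine (HasFDerivAt.comp 0 (by rw [hψ0]; exact hf') hψ').congr_fderiv ?_
    ext u
    simp
  set ζ := hh.localInverse hh' hn with hζ
  have hval : (f ∘ ψ) 0 = extChartAt 𝓘(ℝ, F) s₀ s₀ := by
    change g ((extChartAt 𝓘(ℝ, E) q₀).symm (ψ 0)) = _
    rw [hψ0, hy]
    rfl
  have hζ0 : ζ (extChartAt 𝓘(ℝ, F) s₀ s₀) = 0 := hval ▸ hh.localInverse_apply_image hh' hn
  have hζs : ContDiffAt ℝ ∞ ζ (extChartAt 𝓘(ℝ, F) s₀ s₀) := hval ▸ hh.to_localInverse hh' hn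
  have hζr : ∀ᶠ x in 𝓝 (extChartAt 𝓘(ℝ, F) s₀ s₀), (f ∘ ψ) (ζ x) = x :=
    hval ▸ (hh.hasStrictFDerivAt' hh' hn).eventually_right_inverse
  have hσ0 : (extChartAt 𝓘(ℝ, E) q₀).symm (ψ (ζ (extChartAt 𝓘(ℝ, F) s₀ s₀))) = q₀ := by
    rw [hζ0, hψ0, hy]
  have hσ : ContMDiffAt 𝓘(ℝ, F) 𝓘(ℝ, E) ∞
      (fun s => (extChartAt 𝓘(ℝ, E) q₀).symm (ψ (ζ (extChartAt 𝓘(ℝ, F) s₀ s)))) s₀ := by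
    refine ContMDiffAt.comp (I' := 𝓘(ℝ, E)) (g := (extChartAt 𝓘(ℝ, E) q₀).symm)
      (f := fun s => ψ (ζ (extChartAt 𝓘(ℝ, F) s₀ s))) s₀ ?_ ?_
    · rw [hζ0, hψ0]
      exact hsymm
    · exact (hψ.contDiffAt.comp _ hζs).contMDiffAt.comp s₀ hchart
  refine ⟨fun s => (extChartAt 𝓘(ℝ, E) q₀).symm (ψ (ζ (extChartAt 𝓘(ℝ, F) s₀ s))), hσ0, hσ, ?_⟩
  have hπσ := (C.smooth_shapeProj.continuous.continuousAt.comp' hσ.continuousAt).preimage_mem_nhds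
    (t := (extChartAt 𝓘(ℝ, F) s₀).source) (by
      rw [hσ0]
      exact (isOpen_extChartAt_source s₀).mem_nhds (mem_extChartAt_source s₀))
  filter_upwards [(continuousAt_extChartAt (I := 𝓘(ℝ, F)) s₀).eventually hζr, hπσ,
    (isOpen_extChartAt_source s₀).mem_nhds (mem_extChartAt_source (I := 𝓘(ℝ, F)) s₀)]
    with s h1 h2 h3
  exact (extChartAt 𝓘(ℝ, F) s₀).injOn h2 h3 h1

/-! ### Symmetry, the reduced metric and the reduced Hamiltonian. -/

theorem shapeProj_smul (g : G) (q : Q) : C.shapeProj (g • q) = C.shapeProj q :=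
  ((C.fibre_shapeProj q (g • q)).2 ⟨g, rfl⟩).symm

theorem dproj_smul (g : G) (q : Q) (v : E) :
    C.dproj (g • q) (mfderiv 𝓘(ℝ, E) 𝓘(ℝ, E) (fun p : Q => g • p) q v) = C.dproj q v := by
  have h := mfderiv_comp q (C.smooth_shapeProj.mdifferentiableAt (x := g • q) (by simp))
    ((ContMDiffSMul.contMDiff_const_smul (I := 𝓘(ℝ, EG)) (I' := 𝓘(ℝ, E)) (n := ∞)
      g).mdifferentiableAt (x := q) (by simp))
  have h2 : (C.shapeProj ∘ fun p : Q => g • p) = C.shapeProj := funext (C.shapeProj_smul g)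
  rw [h2] at h
  exact (DFunLike.congr_fun h v).symm

/-- The translated lift lies in `D`, by invariance, and has the same projection; lifts are unique.
-/
theorem horMap_smul (g : G) (q : Q) (u : F) : C.horMap (g • q) u =
    mfderiv 𝓘(ℝ, E) 𝓘(ℝ, E) (fun p : Q => g • p) q (C.horMap q u) := by
  have h : mfderiv 𝓘(ℝ, E) 𝓘(ℝ, E) (fun p : Q => g • p) q (C.horMap q u) ∈ C.D (g • q) := by
    rw [← C.invariant_D g q]
    exact ⟨_, C.horMap_mem q u, rfl⟩
  have h2 := C.horMap_dproj h
  rwa [C.dproj_smul, C.dproj_horMap] at h2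

/-- The reduced kinetic energy metric, `⟪u, v⟫ = ⟪hor u, hor v⟫`. -/
def reducedMetric (q : Q) : F →L[ℝ] F →L[ℝ] ℝ :=
  (show E →L[ℝ] E →L[ℝ] ℝ from C.metric.inner q).bilinearComp (C.horMap q) (C.horMap q)

theorem reducedMetric_apply (q : Q) (u v : F) :
    C.reducedMetric q u v = C.metric.inner q (C.horMap q u) (C.horMap q v) := rfl

/-- Points of one fibre differ by an element of `G`, which acts by isometries and carries lifts to
lifts. -/
theorem reducedMetric_eq {q q' : Q} (h : C.shapeProj q = C.shapeProj q') :
    C.reducedMetric q = C.reducedMetric q' := by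
  obtain ⟨g, rfl⟩ := (C.fibre_shapeProj q q').1 h
  ext u v
  rw [reducedMetric_apply, reducedMetric_apply, C.horMap_smul, C.horMap_smul]
  exact (C.isometry g q _ _).symm

theorem isInvertible_reducedMetric (q : Q) : (C.reducedMetric q).IsInvertible :=
  ContinuousLinearMap.isInvertible_of_pos fun u hu => C.metric.pos q (C.horMap q u) fun h =>
    hu (by rw [← C.dproj_horMap q u]; exact (congrArg (C.dproj q) h).trans (map_zero _))

theorem isInvertible_metric (q : Q) :
    (show E →L[ℝ] E →L[ℝ] ℝ from C.metric.inner q).IsInvertible :=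
  ContinuousLinearMap.isInvertible_of_pos (C.metric.pos q)

/-- The metric, read in the chart around `q₀`. -/
def metricChart (q₀ q : Q) : E →L[ℝ] E →L[ℝ] ℝ :=
  (show E →L[ℝ] E →L[ℝ] ℝ from C.metric.inner q).bilinearComp
    (chartDerivSymm q₀ q) (chartDerivSymm q₀ q)

theorem contMDiffAt_metricChart (q₀ : Q) :
    ContMDiffAt 𝓘(ℝ, E) 𝓘(ℝ, E →L[ℝ] E →L[ℝ] ℝ) ∞ (C.metricChart q₀) q₀ := by
  have h := ((contMDiffAt_hom_bundle _).1 (C.metric.contMDiff q₀)).2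
  refine h.congr_of_eventuallyEq ?_
  filter_upwards [(isOpen_extChartAt_source q₀).mem_nhds
    (mem_extChartAt_source (I := 𝓘(ℝ, E)) q₀)] with q hq
  have hq' : q ∈ (chartAt E q₀).source := by simpa using hq
  have : IsManifold 𝓘(ℝ, E) 1 Q := IsManifold.of_le (n := ∞) (by simp)
  ext v w
  have hs (x : E) : (trivializationAt E (TangentSpace 𝓘(ℝ, E) : Q → Type _) q₀).symm q x =
      (show TangentSpace 𝓘(ℝ, E) q from chartDerivSymm (E := E) q₀ q x) :=
    ((trivializationAt E (TangentSpace 𝓘(ℝ, E) : Q → Type _) q₀).symmL_apply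
      (R := ℝ) (b := q) hq' x).symm.trans
      (DFunLike.congr_fun (TangentBundle.symmL_trivializationAt (I := 𝓘(ℝ, E)) hq') x)
  refine Eq.symm ((inCoordinates_apply_eq₂ hq' hq' (Set.mem_univ q)).trans ?_)
  rw [hs, hs]
  exact congrFun ((trivializationAt ℝ (Bundle.Trivial Q ℝ) q₀).coe_linearMapAt_of_mem
    (R := ℝ) (b := q) (Set.mem_univ q)) _

set_option synthInstance.maxHeartbeats 200000 in
theorem contMDiffAt_reducedMetricChart (q₀ : Q) :
    ContMDiffAt 𝓘(ℝ, E) 𝓘(ℝ, F →L[ℝ] F →L[ℝ] ℝ) ∞ (fun q =>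
      (C.metricChart q₀ q).bilinearComp (C.horChart q₀ q) (C.horChart q₀ q)) q₀ := by
  have h1 := C.contMDiffAt_horChart q₀
  have h2 : ContMDiffAt 𝓘(ℝ, E) 𝓘(ℝ, (E →L[ℝ] ℝ) →L[ℝ] F →L[ℝ] ℝ) ∞ (fun q =>
      (ContinuousLinearMap.compL ℝ F E ℝ).flip (C.horChart q₀ q)) q₀ :=
    ContMDiffAt.comp q₀ (ContinuousLinearMap.contDiff _).contMDiff.contMDiffAt h1
  exact h2.clm_comp ((C.contMDiffAt_metricChart q₀).clm_comp h1)

theorem reducedMetricChart_apply {q₀ q : Q} (hq : q ∈ (extChartAt 𝓘(ℝ, E) q₀).source) (u v : F) :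
    (C.metricChart q₀ q).bilinearComp (C.horChart q₀ q) (C.horChart q₀ q) u v =
      C.reducedMetric q (chartDerivSymm (C.shapeProj q₀) (C.shapeProj q) u)
        (chartDerivSymm (C.shapeProj q₀) (C.shapeProj q) v) :=
  congrArg₂ (fun x y : E => C.metric.inner q x y) (chartDerivSymm_chartDeriv hq _)
    (chartDerivSymm_chartDeriv hq _)

/-- The reduced Hamiltonian on `T*S`. -/
def reducedHamiltonian (a : CotangentBundle F S) : ℝ :=
  1 / 2 * a.2 ((C.reducedMetric (Function.surjInv C.surjective_shapeProj a.1)).inverse a.2) +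
    C.U (Function.surjInv C.surjective_shapeProj a.1)

theorem reducedHamiltonian_eq {a : CotangentBundle F S} {q : Q} (h : C.shapeProj q = a.1) :
    C.reducedHamiltonian a = 1 / 2 * a.2 ((C.reducedMetric q).inverse a.2) + C.U q := by
  have h' : C.shapeProj (Function.surjInv C.surjective_shapeProj a.1) = C.shapeProj q :=
    (Function.surjInv_eq C.surjective_shapeProj a.1).trans h.symm
  rw [reducedHamiltonian, C.reducedMetric_eq h']
  obtain ⟨g, hg⟩ := (C.fibre_shapeProj _ _).1 h'
  rw [← C.invariant_U g, hg]

theorem metric_proj {q : Q} {v : TangentSpace 𝓘(ℝ, E) q} (hv : v ∈ C.D q)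
    (x : TangentSpace 𝓘(ℝ, E) q) :
    C.metric.inner q v x = C.metric.inner q v (C.proj q x : TangentSpace 𝓘(ℝ, E) q) := by
  have hx : x - C.proj q x ∈ C.orthD q := by
    refine (Submodule.projectionOnto_apply_eq_zero_iff (C.isCompl_D_orthD q)).1 ?_
    refine (map_sub (C.proj q) x _).trans ?_
    rw [C.proj_coe, sub_self]
  rw [← sub_eq_zero, ← map_sub, C.metric.symm]
  exact hx v hv

/-- `P^*β` annihilates `D^⊥`, so its metric dual lies in `D` and is the lift of a vector on `S`.
That vector is the dual of the reduced covector for the reduced metric. -/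
theorem metric_horMap_inverse (β : C.DualD) (x : TangentSpace 𝓘(ℝ, E) β.1) :
    C.metric.inner β.1 (C.horMap β.1 ((C.reducedMetric β.1).inverse (C.reduction β).2)) x =
      (C.dualProj β).2 x := by
  set w := (C.reducedMetric β.1).inverse (C.reduction β).2
  have hp := C.horMap_dproj (C.proj β.1 x).2
  have h2 : C.reducedMetric β.1 w (C.dproj β.1 (C.proj β.1 x).1) =
      (C.reduction β).2 (C.dproj β.1 (C.proj β.1 x).1) :=
    DFunLike.congr_fun ((C.isInvertible_reducedMetric β.1).apply_inverse _) _
  refine (C.metric_proj (C.horMap_mem β.1 w) x).trans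
    (((congrArg (C.metric.inner β.1 (C.horMap β.1 w)) hp).symm.trans h2).trans ?_)
  exact congrArg β.2 (Subtype.ext hp)

theorem reducedHamiltonian_reduction (β : C.DualD) :
    C.reducedHamiltonian (C.reduction β) = C.constrainedHamiltonian β := by
  rw [C.reducedHamiltonian_eq (q := β.1) rfl]
  set w := (C.reducedMetric β.1).inverse (C.reduction β).2 with hw
  have h1 : (show E →L[ℝ] E →L[ℝ] ℝ from C.metric.inner β.1).inverse (C.dualProj β).2 =
      C.horMap β.1 w :=
    (C.isInvertible_metric β.1).inverse_eq (ContinuousLinearMap.ext (C.metric_horMap_inverse β))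
  have h2 : (C.dualProj β).2 (C.horMap β.1 w) = (C.reduction β).2 w :=
    congrArg β.2 (C.proj_horMap β.1 w)
  refine congrArg (fun t : ℝ => 1 / 2 * t + C.U β.1) (h2.symm.trans ?_)
  exact congrArg (C.dualProj β).2 h1.symm

/-- By invariance any preimage computes the Hamiltonian, so a smooth local section may replace the
arbitrary choice; the inverse of the reduced metric is smooth because its chart expression is smooth
and invertible. -/
theorem contMDiff_reducedHamiltonian :
    ContMDiff (cotangentModel F) 𝓘(ℝ, ℝ) ∞ C.reducedHamiltonian := by
  intro a
  obtain ⟨q, hq⟩ := C.surjective_shapeProj a.1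
  obtain ⟨σ, hσ0, hσ, hπσ⟩ := C.exists_localSection q
  rw [hq] at hσ0 hσ hπσ
  have hp := contMDiff_cotangentProj (E := F) (M := S) a
  have hσp : ContMDiffAt (cotangentModel F) 𝓘(ℝ, E) ∞ (fun b : CotangentBundle F S => σ b.1) a :=
    hσ.comp a hp
  have ht := contMDiffAt_cotangentTrivialization a
  let K : Q → F →L[ℝ] F →L[ℝ] ℝ := fun p =>
    (C.metricChart q p).bilinearComp (C.horChart q p) (C.horChart q p)
  have hK : ContMDiffAt (cotangentModel F) 𝓘(ℝ, F →L[ℝ] F →L[ℝ] ℝ) ∞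
      (fun b : CotangentBundle F S => K (σ b.1)) a :=
    ContMDiffAt.comp (g := K) a (by rw [hσ0]; exact C.contMDiffAt_reducedMetricChart q) hσp
  have hsrc : q ∈ (extChartAt 𝓘(ℝ, E) q).source := mem_extChartAt_source q
  have hK0 : K (σ a.1) = C.reducedMetric q := by
    ext u v
    rw [hσ0]
    refine (C.reducedMetricChart_apply hsrc u v).trans ?_
    simp
  have hinv : (K (σ a.1)).IsInvertible := hK0 ▸ C.isInvertible_reducedMetric q
  have hU : ContMDiffAt (cotangentModel F) 𝓘(ℝ, ℝ) ∞
      (fun b : CotangentBundle F S => C.U (σ b.1)) a :=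
    ContMDiffAt.comp a C.smooth_U.contMDiffAt hσp
  have hmain := (contMDiffAt_const (c := (1 / 2 : ℝ))).mul
    (ht.clm_apply ((hK.clm_inverse hinv).clm_apply ht)) |>.add hU
  refine hmain.congr_of_eventuallyEq ?_
  filter_upwards [hp.continuousAt.eventually hπσ, hK.eventually_isInvertible hinv,
    hp.continuousAt.preimage_mem_nhds ((isOpen_extChartAt_source a.1).mem_nhds
      (mem_extChartAt_source (I := 𝓘(ℝ, F)) a.1)),
    hσp.continuousAt.preimage_mem_nhds (t := (extChartAt 𝓘(ℝ, E) q).source) (by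
      rw [hσ0]
      exact (isOpen_extChartAt_source q).mem_nhds hsrc)] with b h1 h2 h3 h4
  rw [C.reducedHamiltonian_eq h1]
  refine congrArg (fun t : ℝ => 1 / 2 * t + C.U (σ b.1)) ?_
  set w : F := (C.reducedMetric (σ b.1)).inverse b.2 with hw
  set ℓ := (trivializationAt (F →L[ℝ] ℝ) (fun s : S => TangentSpace 𝓘(ℝ, F) s →L[ℝ] ℝ) a.1 b).2
    with hℓ
  have h5 (u : F) : ℓ u = b.2 (chartDerivSymm (E := F) a.1 b.1 u) :=
    DFunLike.congr_fun (trivializationAt_cotangent_eq_comp h3) u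
  -- The solution `w` of the metric equation, read in the chart, solves the chart form of that
  -- equation; so the two inverses give the same kinetic energy.
  have h6 : K (σ b.1) (chartDeriv a.1 b.1 w) = ℓ := by
    ext v
    refine (C.reducedMetricChart_apply h4 _ v).trans ?_
    rw [hq, h1, chartDerivSymm_chartDeriv h3, h5]
    exact DFunLike.congr_fun ((C.isInvertible_reducedMetric (σ b.1)).apply_inverse b.2) _
  refine Eq.trans ?_ (congrArg ℓ (h2.inverse_eq h6)).symm
  rw [h5, chartDerivSymm_chartDeriv h3]

theorem isReducedHamiltonian_reducedHamiltonian : C.IsReducedHamiltonian C.reducedHamiltonian :=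
  ⟨C.contMDiff_reducedHamiltonian, C.reducedHamiltonian_reduction⟩

/-! ### The gyroscopic tensor: locality, invariance and coordinate expression. -/

theorem eventually_chartDeriv_hor (Y : ∀ s : S, TangentSpace 𝓘(ℝ, F) s) (q₀ : Q) :
    ∀ᶠ q in 𝓝 q₀, chartDeriv (E := E) q₀ q (C.hor Y q) = C.horChart q₀ q
      (chartDeriv (E := F) (C.shapeProj q₀) (C.shapeProj q) (Y (C.shapeProj q))) := by
  filter_upwards [C.smooth_shapeProj.continuous.continuousAt.preimage_mem_nhds
      ((isOpen_extChartAt_source _).mem_nhds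
        (mem_extChartAt_source (I := 𝓘(ℝ, F)) (C.shapeProj q₀)))] with q hq
  refine congrArg (fun u : F => chartDeriv (E := E) q₀ q (C.horMap q u)) ?_
  exact (chartDerivSymm_chartDeriv (E := F) hq _).symm

theorem contMDiffAt_hor [IsManifold 𝓘(ℝ, E) 1 Q] [IsManifold 𝓘(ℝ, F) 1 S]
    {Y : ∀ s : S, TangentSpace 𝓘(ℝ, F) s} {q₀ : Q}
    (hY : ContMDiffAt 𝓘(ℝ, F) (𝓘(ℝ, F)).tangent ∞
      (fun s => (⟨s, Y s⟩ : TangentBundle 𝓘(ℝ, F) S)) (C.shapeProj q₀)) :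
    ContMDiffAt 𝓘(ℝ, E) (𝓘(ℝ, E)).tangent ∞
      (fun q => (⟨q, C.hor Y q⟩ : TangentBundle 𝓘(ℝ, E) Q)) q₀ := by
  refine Bundle.contMDiffAt_totalSpace.2 ⟨contMDiffAt_id, ?_⟩
  have h1 := (Bundle.contMDiffAt_totalSpace.1 hY).2
  have h2 := h1.comp q₀ C.smooth_shapeProj.contMDiffAt
  refine ((C.contMDiffAt_horChart q₀).clm_apply h2).congr_of_eventuallyEq ?_
  filter_upwards [C.eventually_chartDeriv_hor Y q₀, (isOpen_extChartAt_source q₀).mem_nhds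
      (mem_extChartAt_source (I := 𝓘(ℝ, E)) q₀),
    C.smooth_shapeProj.continuous.continuousAt.preimage_mem_nhds
      ((isOpen_extChartAt_source _).mem_nhds
        (mem_extChartAt_source (I := 𝓘(ℝ, F)) (C.shapeProj q₀)))] with q h3 h4 h5
  refine (trivializationAt_tangent_eq_chartDeriv h4 _).trans (h3.trans ?_)
  exact congrArg (C.horChart q₀ q) (trivializationAt_tangent_eq_chartDeriv h5 _).symm

theorem hor_congr {Y Y' : ∀ s : S, TangentSpace 𝓘(ℝ, F) s} {q : Q}
    (h : ∀ᶠ s in 𝓝 (C.shapeProj q), Y s = Y' s) : C.hor Y =ᶠ[𝓝 q] C.hor Y' := by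
  filter_upwards [C.smooth_shapeProj.continuous.continuousAt.eventually h] with p hp
  exact congrArg (fun u => (C.horAt p u : TangentSpace 𝓘(ℝ, E) p)) hp

theorem gyroscopicAt_congr {Y Y' Z Z' : ∀ s : S, TangentSpace 𝓘(ℝ, F) s} {q : Q}
    (hY : ∀ᶠ s in 𝓝 (C.shapeProj q), Y s = Y' s) (hZ : ∀ᶠ s in 𝓝 (C.shapeProj q), Z s = Z' s) :
    C.gyroscopicAt Y Z q = C.gyroscopicAt Y' Z' q := by
  unfold gyroscopicAt
  rw [(C.hor_congr hY).mlieBracket_vectorField_eq (C.hor_congr hZ),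
    Filter.EventuallyEq.mlieBracket_vectorField_eq hY hZ]

/-- Every tangent space of `S` is the model space `F`, so the transport along the equality of base
points is invisible. -/
theorem gyroscopicTensor_eq_surjInv (Y Z : ∀ s : S, TangentSpace 𝓘(ℝ, F) s) (s : S) :
    (C.gyroscopicTensor Y Z s : F) =
      C.gyroscopicAt Y Z (Function.surjInv C.surjective_shapeProj s) := by
  have cast (s s' : S) (h : s = s') (v : TangentSpace 𝓘(ℝ, F) s) :
      ((h ▸ v : TangentSpace 𝓘(ℝ, F) s') : F) = v := by
    subst h
    rfl
  exact cast _ _ (Function.surjInv_eq C.surjective_shapeProj s) _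

theorem gyroscopicTensor_congr {Y Y' Z Z' : ∀ s : S, TangentSpace 𝓘(ℝ, F) s} {s : S}
    (hY : ∀ᶠ x in 𝓝 s, Y x = Y' x) (hZ : ∀ᶠ x in 𝓝 s, Z x = Z' x) :
    C.gyroscopicTensor Y Z s = C.gyroscopicTensor Y' Z' s := by
  have hs := Function.surjInv_eq C.surjective_shapeProj s
  refine (C.gyroscopicTensor_eq_surjInv Y Z s).trans (Eq.trans ?_
    (C.gyroscopicTensor_eq_surjInv Y' Z' s).symm)
  exact C.gyroscopicAt_congr (hs.symm ▸ hY) (hs.symm ▸ hZ)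

/-- The action preserves `D` and the metric, hence also `D^⊥`, so it respects the splitting that
defines `P`. -/
theorem proj_mfderiv_smul (g : G) (q : Q) (v : TangentSpace 𝓘(ℝ, E) q) :
    (C.proj (g • q) (mfderiv 𝓘(ℝ, E) 𝓘(ℝ, E) (fun p : Q => g • p) q v) :
      TangentSpace 𝓘(ℝ, E) (g • q)) =
    mfderiv 𝓘(ℝ, E) 𝓘(ℝ, E) (fun p : Q => g • p) q (C.proj q v) := by
  set T := mfderiv 𝓘(ℝ, E) 𝓘(ℝ, E) (fun p : Q => g • p) q with hT
  have h1 : T (C.proj q v) ∈ C.D (g • q) := by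
    rw [← C.invariant_D g q]
    exact ⟨_, (C.proj q v).2, rfl⟩
  have h2 : T (v - C.proj q v) ∈ C.orthD (g • q) := by
    intro w hw
    rw [← C.invariant_D g q] at hw
    obtain ⟨w', hw', rfl⟩ := hw
    refine (C.isometry g q _ _).trans ?_
    rw [C.metric.symm, map_sub, sub_eq_zero]
    exact C.metric_proj hw' v
  have h3 : v = C.proj q v + (v - C.proj q v) := by abel
  have h4 := congrArg (fun x => C.proj (g • q) (T x)) h3
  simp only [map_add] at h4
  have h5 : C.proj (g • q) (T (v - C.proj q v)) = 0 :=
    (Submodule.projectionOnto_apply_eq_zero_iff (C.isCompl_D_orthD (g • q))).2 h2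
  rw [h4, h5, add_zero]
  exact congrArg Subtype.val (C.proj_coe (g • q) ⟨_, h1⟩)

theorem mpullback_hor (g : G) (Y : ∀ s : S, TangentSpace 𝓘(ℝ, F) s) :
    VectorField.mpullback 𝓘(ℝ, E) 𝓘(ℝ, E) (fun p : Q => g • p) (C.hor Y) = C.hor Y := by
  funext q
  have h : C.hor Y (g • q) = mfderiv 𝓘(ℝ, E) 𝓘(ℝ, E) (fun p : Q => g • p) q (C.hor Y q) := by
    let Y' : S → F := Y
    refine Eq.trans ?_ (C.horMap_smul g q (Y' (C.shapeProj q)))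
    exact congrArg (fun s => C.horMap (g • q) (Y' s)) (C.shapeProj_smul g q)
  rw [VectorField.mpullback_apply, h]
  obtain ⟨e, he⟩ := isInvertible_mfderiv_smul (E := E) EG g q
  rw [← he, ContinuousLinearMap.inverse_equiv]
  exact e.symm_apply_apply _

section Smooth

variable {Y Z : ∀ s : S, TangentSpace 𝓘(ℝ, F) s}

theorem mlieBracket_hor_smul [IsManifold 𝓘(ℝ, E) 1 Q] [IsManifold 𝓘(ℝ, F) 1 S]
    (hY : IsSmoothField 𝓘(ℝ, F) Y) (hZ : IsSmoothField 𝓘(ℝ, F) Z) (g : G) (q : Q) :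
    VectorField.mlieBracket 𝓘(ℝ, E) (C.hor Y) (C.hor Z) (g • q) =
      mfderiv 𝓘(ℝ, E) 𝓘(ℝ, E) (fun p : Q => g • p) q
        (VectorField.mlieBracket 𝓘(ℝ, E) (C.hor Y) (C.hor Z) q) := by
  have : IsManifold 𝓘(ℝ, E) (minSmoothness ℝ 3) Q := IsManifold.of_le (n := ∞)
    (by rw [minSmoothness_of_isRCLikeNormedField]; exact WithTop.coe_le_coe.2 le_top)
  have h := VectorField.mpullback_mlieBracket (f := fun p : Q => g • p) (n := ∞) (x₀ := q)
    ((C.contMDiffAt_hor (hY (C.shapeProj (g • q)))).mdifferentiableAt (by simp))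
    ((C.contMDiffAt_hor (hZ (C.shapeProj (g • q)))).mdifferentiableAt (by simp))
    (ContMDiffSMul.contMDiff_const_smul (I := 𝓘(ℝ, EG)) (I' := 𝓘(ℝ, E)) (n := ∞) g).contMDiffAt
    minSmoothness_two_le_infty
  rw [C.mpullback_hor, C.mpullback_hor, VectorField.mpullback_apply] at h
  obtain ⟨e, he⟩ := isInvertible_mfderiv_smul (E := E) EG g q
  rw [← h, ← he, ContinuousLinearMap.inverse_equiv]
  exact (e.apply_symm_apply _).symm

theorem gyroscopicAt_smul (hY : IsSmoothField 𝓘(ℝ, F) Y) (hZ : IsSmoothField 𝓘(ℝ, F) Z) (g : G)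
    (q : Q) : (C.gyroscopicAt Y Z (g • q) : F) = C.gyroscopicAt Y Z q := by
  let B : S → F := VectorField.mlieBracket 𝓘(ℝ, F) Y Z
  refine congrArg₂ (fun u v : F => u - v) ?_ (congrArg B (C.shapeProj_smul g q))
  rw [C.mlieBracket_hor_smul hY hZ, C.proj_mfderiv_smul]
  exact C.dproj_smul g q _

/-- Frees the tensor from the chosen preimage. Smoothness of the fields is used because invariance
of the bracket comes from its naturality under pull-back. -/
theorem gyroscopicTensor_shapeProj (hY : IsSmoothField 𝓘(ℝ, F) Y) (hZ : IsSmoothField 𝓘(ℝ, F) Z)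
    (q : Q) : (C.gyroscopicTensor Y Z (C.shapeProj q) : F) = C.gyroscopicAt Y Z q := by
  obtain ⟨g, hg⟩ := (C.fibre_shapeProj _ _).1
    (Function.surjInv_eq C.surjective_shapeProj (C.shapeProj q)).symm
  refine (C.gyroscopicTensor_eq_surjInv Y Z _).trans ?_
  rw [← hg]
  exact C.gyroscopicAt_smul hY hZ g q

end Smooth

/-- In charts the lift of the constant field `w` is `q ↦ horChart q w`, so the bracket is the
antisymmetrised derivative of the lift. -/
theorem mlieBracket_hor_extend (q : Q) (u v : F) :
    VectorField.mlieBracket 𝓘(ℝ, E)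
      (C.hor (FiberBundle.extend F (show TangentSpace 𝓘(ℝ, F) (C.shapeProj q) from u)))
      (C.hor (FiberBundle.extend F (show TangentSpace 𝓘(ℝ, F) (C.shapeProj q) from v))) q =
      C.dhor q (C.horMap q u) v - C.dhor q (C.horMap q v) u := by
  have h0 := (C.contMDiffAt_horChart q).mdifferentiableAt (by simp)
  have hA (w : F) : MDifferentiableAt 𝓘(ℝ, E) 𝓘(ℝ, E) (fun p => C.horChart q p w) q :=
    h0.clm_apply mdifferentiableAt_const
  have hA' (w : F) (x : E) : (show E →L[ℝ] E from
      mfderiv 𝓘(ℝ, E) 𝓘(ℝ, E) (fun p => C.horChart q p w) q) x = C.dhor q x w :=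
    DFunLike.congr_fun (mfderiv_comp q (I' := 𝓘(ℝ, F →L[ℝ] E))
      (g := ContinuousLinearMap.apply ℝ E w)
      (ContinuousLinearMap.mdifferentiableAt _) h0) x |>.trans (by
        rw [ContinuousLinearMap.mfderiv_eq]; rfl)
  have hext (w : F) : ∀ᶠ p in 𝓝 q, chartDeriv (E := E) q p
      (C.hor (FiberBundle.extend F (show TangentSpace 𝓘(ℝ, F) (C.shapeProj q) from w)) p) =
        C.horChart q p w := by
    filter_upwards [C.eventually_chartDeriv_hor _ q,
      C.smooth_shapeProj.continuous.continuousAt.eventually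
        (eventually_chartDeriv_extend (C.shapeProj q) w)] with p h1 h2
    rw [h1, h2]
  have hval (w : F) :
      C.hor (FiberBundle.extend F (show TangentSpace 𝓘(ℝ, F) (C.shapeProj q) from w)) q =
        C.horMap q w :=
    congrArg (C.horMap q) (FiberBundle.extend_apply_self (F := F)
      (show TangentSpace 𝓘(ℝ, F) (C.shapeProj q) from w))
  refine (mlieBracket_eq_of_chartDeriv (hA u) (hA v) (hext u) (hext v)).trans ?_
  exact congrArg₂ (fun x y : E => x - y)
    ((hA' v _).trans (congrArg (fun x : E => C.dhor q x v) (hval u)))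
    ((hA' u _).trans (congrArg (fun x : E => C.dhor q x u) (hval v)))

theorem gyroscopicAt_extend (q : Q) (u v : F) :
    (C.gyroscopicAt (FiberBundle.extend F (show TangentSpace 𝓘(ℝ, F) (C.shapeProj q) from u))
      (FiberBundle.extend F (show TangentSpace 𝓘(ℝ, F) (C.shapeProj q) from v)) q : F) =
      C.dproj q (C.proj q (show TangentSpace 𝓘(ℝ, E) q from
        C.dhor q (C.horMap q u) v - C.dhor q (C.horMap q v) u)).1 := by
  unfold gyroscopicAt
  rw [mlieBracket_extend, C.mlieBracket_hor_extend]
  exact sub_zero (_ : F)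

section Simple

variable [T2Space S] {φ : S → ℝ}

/-- Simplicity speaks of globally smooth fields, while `extend` is only locally smooth. The fields
are cut off by a bump function, which is harmless because the tensor depends only on germs. -/
theorem IsSimple.gyroscopicTensor_extend {C : ChaplyginSystem E Q EG G F S r} (hφ : C.IsSimple φ)
    (s : S) (u v : TangentSpace 𝓘(ℝ, F) s) :
    C.gyroscopicTensor (FiberBundle.extend F u) (FiberBundle.extend F v) s =
      dirDeriv 𝓘(ℝ, F) φ s v • u - dirDeriv 𝓘(ℝ, F) φ s u • v := by
  obtain ⟨Y, hY, hYu⟩ := exists_isSmoothField_eventuallyEq_extend s u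
  obtain ⟨Z, hZ, hZv⟩ := exists_isSmoothField_eventuallyEq_extend s v
  have h1 : Y s = u := hYu.self_of_nhds.trans (FiberBundle.extend_apply_self (F := F) u)
  have h2 : Z s = v := hZv.self_of_nhds.trans (FiberBundle.extend_apply_self (F := F) v)
  rw [← C.gyroscopicTensor_congr hYu hZv, hφ.2 Y Z hY hZ s, h1, h2]

/-- The bracket of the base fields vanishes, so the left side is the gyroscopic tensor on constant
fields. The identity holds at every `q`, as needed when comparing with the dynamics on all of `D*`.
-/
theorem IsSimple.dproj_proj_bracket {C : ChaplyginSystem E Q EG G F S r} (hφ : C.IsSimple φ)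
    (q : Q) (u v : F) :
    C.dproj q (C.proj q (show TangentSpace 𝓘(ℝ, E) q from
        C.dhor q (C.horMap q u) v - C.dhor q (C.horMap q v) u)).1 =
      dirDeriv 𝓘(ℝ, F) φ (C.shapeProj q) v • u - dirDeriv 𝓘(ℝ, F) φ (C.shapeProj q) u • v := by
  obtain ⟨Y, hY, hYu⟩ := exists_isSmoothField_eventuallyEq_extend (C.shapeProj q) u
  obtain ⟨Z, hZ, hZv⟩ := exists_isSmoothField_eventuallyEq_extend (C.shapeProj q) v
  rw [← C.gyroscopicAt_extend, ← C.gyroscopicAt_congr hYu hZv,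
    ← C.gyroscopicTensor_shapeProj hY hZ, C.gyroscopicTensor_congr hYu hZv]
  exact hφ.gyroscopicTensor_extend _ _ _

/-- This is `Ω_𝒯 = λ ∧ dφ`, the correction that turns `exp(φ) Ω_can` into the exact form `-d(exp(φ)
λ)`. -/
theorem IsSimple.gyroscopicForm_apply {C : ChaplyginSystem E Q EG G F S r} (hφ : C.IsSimple φ)
    (α : CotangentBundle F S) (U V : F × (F →L[ℝ] ℝ)) :
    C.gyroscopicForm α U V = dirDeriv 𝓘(ℝ, F) φ α.1 V.1 * α.2 U.1 -
      dirDeriv 𝓘(ℝ, F) φ α.1 U.1 * α.2 V.1 := by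
  have key (u v : TangentSpace 𝓘(ℝ, F) α.1) :
      α.2 (C.gyroscopicTensor (FiberBundle.extend F u) (FiberBundle.extend F v) α.1) =
        dirDeriv 𝓘(ℝ, F) φ α.1 v * α.2 u - dirDeriv 𝓘(ℝ, F) φ α.1 u * α.2 v := by
    rw [hφ.gyroscopicTensor_extend, map_sub, map_smul, map_smul, smul_eq_mul, smul_eq_mul]
  exact (key _ _).trans (congrArg₂ (fun u v : F => dirDeriv 𝓘(ℝ, F) φ α.1 v * α.2 u -
    dirDeriv 𝓘(ℝ, F) φ α.1 u * α.2 v) (mfderiv_cotangent_proj α U) (mfderiv_cotangent_proj α V))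

end Simple

/-! ### Reduced dynamics and the Hamiltonian equation. -/

theorem dirDeriv_comp_cotangentReduction {h : CotangentBundle F S → ℝ}
    {α : CotangentBundle E Q}
    (hh : MDifferentiableAt (cotangentModel F) 𝓘(ℝ, ℝ) h (C.cotangentReduction α)) (V : E × (E →L[ℝ] ℝ)) :
    dirDeriv (cotangentModel E) (h ∘ C.cotangentReduction) α V =
      (show F × (F →L[ℝ] ℝ) →L[ℝ] ℝ from
        mfderiv (cotangentModel F) 𝓘(ℝ, ℝ) h (C.cotangentReduction α))
        (C.dproj α.1 V.1, V.2.comp (C.horMap α.1) +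
          (show E →L[ℝ] ℝ from α.2).comp (C.dhor α.1 V.1)) := by
  have hρ : MDifferentiableAt (cotangentModel E) (cotangentModel F) C.cotangentReduction α :=
    C.contMDiff_cotangentReduction.mdifferentiableAt (by simp)
  refine (DFunLike.congr_fun (mfderiv_comp α hh hρ) V).trans ?_
  exact congrArg (show F × (F →L[ℝ] ℝ) →L[ℝ] ℝ from
        mfderiv (cotangentModel F) 𝓘(ℝ, ℝ) h (C.cotangentReduction α))
    (C.mfderiv_cotangentReduction α V)

/-- The canonical bracket of two functions pulled back from `T*S`; `g` and `k` are their derivatives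
along the fibres of `T*S`. -/
theorem poissonBracket_comp_cotangentReduction {f h : CotangentBundle F S → ℝ}
    {α : CotangentBundle E Q}
    (hf : MDifferentiableAt (cotangentModel F) 𝓘(ℝ, ℝ) f (C.cotangentReduction α))
    (hh : MDifferentiableAt (cotangentModel F) 𝓘(ℝ, ℝ) h (C.cotangentReduction α)) {g k : F}
    (hg : ∀ (u : F) (w : F →L[ℝ] ℝ),
      dirDeriv (cotangentModel F) h (C.cotangentReduction α) (show F × (F →L[ℝ] ℝ) from (u, w)) =
        dirDeriv (cotangentModel F) h (C.cotangentReduction α)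
          (show F × (F →L[ℝ] ℝ) from (u, 0)) + w g)
    (hk : ∀ (u : F) (w : F →L[ℝ] ℝ),
      dirDeriv (cotangentModel F) f (C.cotangentReduction α) (show F × (F →L[ℝ] ℝ) from (u, w)) =
        dirDeriv (cotangentModel F) f (C.cotangentReduction α)
          (show F × (F →L[ℝ] ℝ) from (u, 0)) + w k) :
    poissonBracket (f ∘ C.cotangentReduction) (h ∘ C.cotangentReduction) α =
      dirDeriv (cotangentModel F) f (C.cotangentReduction α)
          (show F × (F →L[ℝ] ℝ) from (g, 0)) -
        dirDeriv (cotangentModel F) h (C.cotangentReduction α)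
          (show F × (F →L[ℝ] ℝ) from (k, 0)) +
        (show E →L[ℝ] ℝ from α.2)
          (C.dhor α.1 (C.horMap α.1 g) k - C.dhor α.1 (C.horMap α.1 k) g) := by
  let a : E →L[ℝ] ℝ := α.2
  set Y : E × (E →L[ℝ] ℝ) := hamiltonianVector canonicalForm (h ∘ C.cotangentReduction) α with hY
  have hspec (V : E × (E →L[ℝ] ℝ)) : V.2 Y.1 - Y.2 V.1 =
      dirDeriv (cotangentModel F) h (C.cotangentReduction α)
        (show F × (F →L[ℝ] ℝ) from (C.dproj α.1 V.1, 0)) +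
      (V.2 (C.horMap α.1 g) + a (C.dhor α.1 V.1 g)) :=
    (canonicalForm_apply α Y V).symm.trans ((hamiltonianVector_spec (η := canonicalForm)
      (canonicalForm_nondegenerate α) (h ∘ C.cotangentReduction) V).trans
      ((C.dirDeriv_comp_cotangentReduction hh V).trans (hg _ _)))
  have h0 : dirDeriv (cotangentModel F) h (C.cotangentReduction α)
      (show F × (F →L[ℝ] ℝ) from (0, 0)) = 0 :=
    map_zero (mfderiv (cotangentModel F) 𝓘(ℝ, ℝ) h (C.cotangentReduction α))
  -- Vertical test vectors show that the Hamiltonian vector has a horizontal base component, the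
  -- lift of `g`.
  have hY1 : Y.1 = C.horMap α.1 g := eq_of_forall_clm_apply_eq fun w => by
    have := hspec (0, w)
    simpa [h0] using this
  -- The derivative of `f ∘ ρ` involves the fibre component of `Y` only through its value on `hor
  -- k`, so this single test vector suffices.
  have hY2 := hspec (C.horMap α.1 k, 0)
  have hmain : dirDeriv (cotangentModel E) (f ∘ C.cotangentReduction) α Y =
      dirDeriv (cotangentModel F) f (C.cotangentReduction α)
        (show F × (F →L[ℝ] ℝ) from (C.dproj α.1 Y.1, 0)) +
      (Y.2 (C.horMap α.1 k) + a (C.dhor α.1 Y.1 k)) :=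
    (C.dirDeriv_comp_cotangentReduction hf Y).trans (hk _ _)
  rw [hY1, dproj_horMap] at hmain
  simp only [dproj_horMap, zero_apply, zero_sub, zero_add] at hY2
  refine hmain.trans ?_
  change _ = _ - _ + a _
  rw [map_sub]
  linarith

/-- `P^*β` sees only the `D`-part of the bracket, which is the horizontal lift of the value of `𝒯`;
this is where the simplicity hypothesis enters the dynamics. -/
theorem dualProj_bracket [T2Space S] {φ : S → ℝ} (hφ : C.IsSimple φ) (β : C.DualD) (u v : F) :
    (show E →L[ℝ] ℝ from (C.dualProj β).2)
      (C.dhor β.1 (C.horMap β.1 u) v - C.dhor β.1 (C.horMap β.1 v) u) =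
      dirDeriv 𝓘(ℝ, F) φ (C.shapeProj β.1) v * (C.reduction β).2 u -
        dirDeriv 𝓘(ℝ, F) φ (C.shapeProj β.1) u * (C.reduction β).2 v := by
  set x : TangentSpace 𝓘(ℝ, E) β.1 :=
    (C.dhor β.1 (C.horMap β.1 u) v - C.dhor β.1 (C.horMap β.1 v) u : E) with hx
  have h1 : C.horAt β.1 (C.dproj β.1 (C.proj β.1 x).1) = C.proj β.1 x :=
    Subtype.ext (C.horMap_dproj (C.proj β.1 x).2)
  have h2 : (C.dualProj β).2 x = (C.reduction β).2 (C.dproj β.1 (C.proj β.1 x).1) :=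
    (congrArg β.2 h1).symm
  refine h2.trans ((congrArg (C.reduction β).2 (hφ.dproj_proj_bracket β.1 u v)).trans ?_)
  refine (map_sub (show F →L[ℝ] ℝ from (C.reduction β).2) _ _).trans ?_
  exact congrArg₂ (· - ·) (map_smul (show F →L[ℝ] ℝ from (C.reduction β).2) _ _)
    (map_smul (show F →L[ℝ] ℝ from (C.reduction β).2) _ _)

/-- The reduced vector field of a `φ`-simple system. -/
def reducedField (φ : S → ℝ) (α : CotangentBundle F S) : TangentSpace (cotangentModel F) α :=
  Real.exp (φ α.1) • hamiltonianVector (conformalForm φ) C.reducedHamiltonian α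

theorem isSmoothField_reducedField {φ : S → ℝ} (hφ : ContMDiff 𝓘(ℝ, F) 𝓘(ℝ, ℝ) ∞ φ) :
    IsSmoothField (cotangentModel F) (C.reducedField φ) :=
  ContMDiff.smul_section (Real.contDiff_exp.contMDiff.comp (hφ.comp contMDiff_cotangentProj))
    ((isSymplecticForm_conformalForm hφ).isSmoothField_hamiltonianVector
      C.contMDiff_reducedHamiltonian)

theorem conformalForm_reducedField {φ : S → ℝ} (hφ : ContMDiff 𝓘(ℝ, F) 𝓘(ℝ, ℝ) ∞ φ)
    (α : CotangentBundle F S) (V : TangentSpace (cotangentModel F) α) :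
    conformalForm φ α ![Real.exp (-φ α.1) • C.reducedField φ α, V] =
      dirDeriv (cotangentModel F) C.reducedHamiltonian α V := by
  rw [reducedField, smul_smul, ← Real.exp_add, neg_add_cancel, Real.exp_zero, one_smul]
  exact hamiltonianVector_spec ((isSymplecticForm_conformalForm hφ).nondegenerate α) _ V

/-- The counterpart on `T*S` of `poissonBracket_comp_cotangentReduction`, with the gyroscopic term
in place of the bracket of lifts. -/
theorem dirDeriv_reducedField {φ : S → ℝ} (hφ : ContMDiff 𝓘(ℝ, F) 𝓘(ℝ, ℝ) ∞ φ)
    {f : CotangentBundle F S → ℝ} (α : CotangentBundle F S) {g k : F}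
    (hg : ∀ (u : F) (w : F →L[ℝ] ℝ),
      dirDeriv (cotangentModel F) C.reducedHamiltonian α (show F × (F →L[ℝ] ℝ) from (u, w)) =
        dirDeriv (cotangentModel F) C.reducedHamiltonian α
          (show F × (F →L[ℝ] ℝ) from (u, 0)) + w g)
    (hk : ∀ (u : F) (w : F →L[ℝ] ℝ),
      dirDeriv (cotangentModel F) f α (show F × (F →L[ℝ] ℝ) from (u, w)) =
        dirDeriv (cotangentModel F) f α (show F × (F →L[ℝ] ℝ) from (u, 0)) + w k) :
    dirDeriv (cotangentModel F) f α (C.reducedField φ α) =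
      dirDeriv (cotangentModel F) f α (show F × (F →L[ℝ] ℝ) from (g, 0)) -
        dirDeriv (cotangentModel F) C.reducedHamiltonian α
          (show F × (F →L[ℝ] ℝ) from (k, 0)) +
        (dirDeriv 𝓘(ℝ, F) φ α.1 k * α.2 g - dirDeriv 𝓘(ℝ, F) φ α.1 g * α.2 k) := by
  let a : F →L[ℝ] ℝ := α.2
  let dφ : F →L[ℝ] ℝ := mfderiv 𝓘(ℝ, F) 𝓘(ℝ, ℝ) φ α.1
  set X : F × (F →L[ℝ] ℝ) := C.reducedField φ α with hX
  -- The time rescaling cancels the conformal factor, leaving the contraction of `X` with the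
  -- unscaled `Ω_nh`.
  have hspec (V : F × (F →L[ℝ] ℝ)) : V.2 X.1 - X.2 V.1 + (dφ V.1 * a X.1 - dφ X.1 * a V.1) =
      dirDeriv (cotangentModel F) C.reducedHamiltonian α
        (show F × (F →L[ℝ] ℝ) from (V.1, 0)) + V.2 g := by
    refine Eq.trans ?_ ((C.conformalForm_reducedField hφ α V).trans (hg V.1 V.2))
    refine Eq.trans ?_ (conformalForm_apply hφ α (Real.exp (-φ α.1) • X) V).symm
    change _ = Real.exp (φ α.1) * (V.2 (Real.exp (-φ α.1) • X.1) -
      (Real.exp (-φ α.1) • X.2) V.1 + (dφ V.1 * a (Real.exp (-φ α.1) • X.1) -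
        dφ (Real.exp (-φ α.1) • X.1) * a V.1))
    have he : Real.exp (φ α.1) * Real.exp (-φ α.1) = 1 := by
      rw [← Real.exp_add, add_neg_cancel, Real.exp_zero]
    simp only [map_smul, smul_apply, smul_eq_mul]
    linear_combination (-(V.2 X.1 - X.2 V.1 + (dφ V.1 * a X.1 - dφ X.1 * a V.1))) * he
  have h0 : dirDeriv (cotangentModel F) C.reducedHamiltonian α
      (show F × (F →L[ℝ] ℝ) from (0, 0)) = 0 :=
    map_zero (mfderiv (cotangentModel F) 𝓘(ℝ, ℝ) C.reducedHamiltonian α)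
  have hX1 : X.1 = g := eq_of_forall_clm_apply_eq fun w => by
    have := hspec (0, w)
    simpa [h0] using this
  have hX2 := hspec (k, 0)
  refine (hk X.1 X.2).trans ?_
  rw [hX1] at hX2 ⊢
  simp only [zero_apply, zero_sub, add_zero] at hX2
  change _ = _ - _ + (dφ k * a g - dφ g * a k)
  linarith

theorem isReducedField_reducedField [T2Space S] {φ : S → ℝ} (hφ : C.IsSimple φ) :
    C.IsReducedField (C.reducedField φ) := by
  refine ⟨C.isSmoothField_reducedField hφ.1, fun f hf β => ?_⟩
  have hh := C.contMDiff_reducedHamiltonian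
  have hρ : C.cotangentReduction (C.dualProj β) = C.reduction β := C.cotangentReduction_dualProj β
  obtain ⟨g, hg⟩ := exists_forall_prod_apply_eq (V := F)
    (mfderiv (cotangentModel F) 𝓘(ℝ, ℝ) C.reducedHamiltonian (C.reduction β))
  obtain ⟨k, hk⟩ := exists_forall_prod_apply_eq (V := F)
    (mfderiv (cotangentModel F) 𝓘(ℝ, ℝ) f (C.reduction β))
  -- By definition `reduction ∘ dualIncl` is `cotangentReduction`, so `H ∘ reduction = h_c` pulls
  -- back to all of `T*Q`; both arguments of the canonical bracket are then functions of `ρ`.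
  have hc : C.constrainedHamiltonian ∘ C.dualIncl =
      C.reducedHamiltonian ∘ C.cotangentReduction := by
    funext α
    exact (C.reducedHamiltonian_reduction (C.dualIncl α)).symm
  have h1 := C.poissonBracket_comp_cotangentReduction (f := f) (h := C.reducedHamiltonian)
    (α := C.dualProj β) (g := g) (k := k) (hf.mdifferentiableAt (by simp))
    (hh.mdifferentiableAt (by simp)) (hρ ▸ hg) (hρ ▸ hk)
  have h2 : C.dynamics (f ∘ C.reduction) β = poissonBracket (f ∘ C.cotangentReduction)
      (C.reducedHamiltonian ∘ C.cotangentReduction) (C.dualProj β) :=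
    congrArg (fun h => poissonBracket (f ∘ C.cotangentReduction) h (C.dualProj β)) hc
  refine (C.dirDeriv_reducedField hφ.1 (C.reduction β) hg hk).trans (Eq.trans ?_ (h1.symm.trans h2.symm))
  rw [hρ]
  exact congrArg _ (C.dualProj_bracket hφ β g k).symm

end ChaplyginSystem

end

theorem corollaryl {E Q EG G F S : Type*}
    [NormedAddCommGroup E] [NormedSpace ℝ E] [FiniteDimensional ℝ E]
    [TopologicalSpace Q] [T2Space Q] [SecondCountableTopology Q]
    [ChartedSpace E Q] [IsManifold 𝓘(ℝ, E) ∞ Q]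
    [NormedAddCommGroup EG] [NormedSpace ℝ EG] [FiniteDimensional ℝ EG]
    [Group G] [TopologicalSpace G] [T2Space G] [SecondCountableTopology G]
    [ChartedSpace EG G] [LieGroup 𝓘(ℝ, EG) ∞ G]
    [MulAction G Q] [ContMDiffSMul 𝓘(ℝ, EG) 𝓘(ℝ, E) ∞ G Q] [ProperSMul G Q]
    [NormedAddCommGroup F] [NormedSpace ℝ F] [FiniteDimensional ℝ F]
    [TopologicalSpace S] [T2Space S] [SecondCountableTopology S]
    [ChartedSpace F S] [IsManifold 𝓘(ℝ, F) ∞ S] {r : ℕ}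
    (C : ChaplyginSystem E Q EG G F S r) (φ : S → ℝ) (hφ : C.IsSimple φ) :
    ∃ Ω : DiffForm (cotangentModel F) (CotangentBundle F S) 2,
      (∀ (α : CotangentBundle F S) (U V : TangentSpace (cotangentModel F) α),
        Ω α ![U, V] = Real.exp (φ α.1) * C.nonholonomicForm α U V) ∧
      C.IsHamiltonisableWith (fun s => Real.exp (-φ s)) Ω := by
  -- The Hamiltonian equation holds by construction of `reducedField`; what remains is that
  -- `-d(exp(φ) λ)` equals `exp(φ) Ω_nh` pointwise.
  refine ⟨conformalForm φ, fun α U V => ?_, fun s => Real.exp_pos _,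
    Real.contDiff_exp.contMDiff.comp hφ.1.neg, isSymplecticForm_conformalForm hφ.1,
    C.reducedHamiltonian, C.reducedField φ, C.isReducedHamiltonian_reducedHamiltonian,
    C.isReducedField_reducedField hφ, C.conformalForm_reducedField hφ.1⟩
  refine (conformalForm_apply hφ.1 α U V).trans (congrArg (Real.exp (φ α.1) * ·) ?_)
  exact (congrArg₂ (· + ·) (canonicalForm_apply α U V) (hφ.gyroscopicForm_apply α U V)).symm
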